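/- **Setting.** Let $n\ge 2$, $0<\kappa<1$, $0<c_1<c_2$, let $\Omega\subseteq S^{n-1}$ be (relatively) open, let $\Sigma\subseteq\mathbb R^n$, and put $\Gamma=\{rx: x\in\Omega,\ c_1\le r\le c_2\}$. For $X\neq 0$ write $\operatorname{dir}X=X/|X|$. For $x,Y,X_0\in\mathbb R^n$ let $$h(x,Y,X_0)=\frac{b-\kappa^2x\cdot Y-\sqrt{(b-\kappa^2x\cdot Y)^2-(1-\kappa^2)(b^2-\kappa^2|Y|^2)}}{1-\kappa^2},\qquad b=|X_0|+\kappa|X_0-Y|,$$ which for $|x|=1$ is the polar radius of the Descartes oval $\{X:|X|+\kappa|X-Y|=b\}$ through $X_0$. For $x_0,\bar m,\hat m\in S^{n-1}$ with $\bar m\cdot x_0,\hat m\cdot x_0\ge\kappa$ and $\lambda\in[0,1]$ let $m_\lambda=(1-\lambda)\bar m+\lambda\hat m$, $\xi=m_\lambda-x_0/\kappa$, $$\beta(\lambda)=\frac{-x_0\cdot\xi-\sqrt{(x_0\cdot\xi)^2-(1-\kappa^2)|\xi|^2}}{\kappa|\xi|^2},\qquad m(\lambda)=\frac{x_0}{\kappa}+\beta(\lambda)\,\xi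 ,$$ and $[\bar m,\hat m]_{x_0}=\{m(\lambda):0\le\lambda\le1\}$ (the intersection of $S^{n-1}$ with the triangle with vertices $\bar m,\hat m,x_0/\kappa$). **Hypotheses.** * **H.A** (a) $\operatorname{dir}X\cdot\operatorname{dir}(Y-X)\ge\kappa$ for all $X\in\Gamma$, $Y\in\Sigma$. (b) For each $X\in\Gamma$ there are a set $E(X)\subseteq\{m\in S^{n-1}:m\cdot\operatorname{dir}X\ge\kappa\}$ and a continuous $s_X:E(X)\to(0,\infty)$ with $\Sigma=\{X+s_X(m)m:m\in E(X)\}$ and $[\bar m,\hat m]_{\operatorname{dir}X}\subseteq E(X)$ for all $\bar m,\hat m\in E(X)$. (c) There is $C>0$ with $|s_X(m_1)-s_X(m_2)|\le C|m_1-m_2|$ for all $X\in\Gamma$ and $m_1,m_2\in E(X)$. * **H.B** $|X|/|Y-X|\le\kappa\left(\sqrt{1+(1+\kappa)^{-2}}-1\right)$ for all $X\in\Gamma$, $Y\in\Sigma$. * **H.C** There is $0\le\mu<\kappa$ such that for all $X_0\in\Gamma$, $\bar m,\hat m\in E(X_0)$ and $\lambda\in[0,1]$, with $x_0=\operatorname{dir}X_0$,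 $$\frac1{s_{X_0}(m(\lambda))}+\frac{\mu}{|X_0|}\ \ge\ (1-\lambda)\beta(\lambda)\Big(\frac1{s_{X_0}(\bar m)}+\frac{\mu}{|X_0|}\Big)+\lambda\beta(\lambda)\Big(\frac1{s_{X_0}(\hat m)}+\frac{\mu}{|X_0|}\Big).$$ * **H.D** There are $\mu_0>0$ and $C>0$ such that for all $X_0\in\Gamma$, $\bar Y,\hat Y\in\Sigma$ and $0<\mu\le\mu_0$, $$H^{n-1}\big(N_\mu(\{Y(\lambda):\tfrac14\le\lambda\le\tfrac34\})\cap\Sigma\big)\ge C\mu^{n-2}|\bar Y-\hat Y|,$$ where $Y(\lambda)=X_0+s_{X_0}(m(\lambda))m(\lambda)$ with $x_0=\operatorname{dir}X_0$, $\bar m=\operatorname{dir}(\bar Y-X_0)$, $\hat m=\operatorname{dir}(\hat Y-X_0)$, $N_\mu$ is the $\mu$-neighbourhood in $\mathbb R^n$ and $H^{n-1}$ is the $(n-1)$-dimensional Hausdorff measure. For $u:\Omega\to[c_1,c_2]$ and $x_0\in\Omega$ let $\partial u(x_0)$ be the set of $Y\in\Sigma$ such that $u(x)\ge h(x,Y,u(x_0)x_0)$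 for all $x\in\Omega$; $u$ is a *refractor from $\Omega$ to $\Sigma$* if $\partial u(x_0)\ne\emptyset$ for all $x_0\in\Omega$. **Theorem.** Assume H.A, H.B, H.C and H.D, and let $u$ be a refractor from $\Omega$ to $\Sigma$ for which there is a constant $C$ such that $H^{n-1}\big(\bigcup_{x\in B_\sigma\cap S^{n-1}}\partial u(x)\big)\le C\sigma^{n-1}$ for every ball $B_\sigma$ of radius $\sigma>0$ centred on $S^{n-1}$ with $B_\sigma\cap S^{n-1}\subseteq\Omega$. Then $u\in C^{1,\alpha}_{\rm loc}(\Omega)$ with $\alpha=\frac1{4n-5}$; that is, $\tilde u(X)=u(X/|X|)$ is differentiable at every point of $\Omega$, and for every compact $K\subseteq\Omega$ there is $C_K$ with $|\nabla\tilde u(\bar x)-\nabla\tilde u(\hat x)|\le C_K|\bar x-\hat x|^{\alpha}$ for all $\bar x,\hat x\in K$. Moreover, for every $x_0\in\Omega$ the set $\partial u(x_0)$ is a single point $Y$, the function $h(\cdot,Y,X_0)$ with $X_0=u(x_0)x_0$ is differentiable at $x_0$, and $$\nabla\tilde u(x_0)=\nabla h(x_0,Y,X_0)-\langle\nabla h(x_0,Y,X_0),x_0\rangle\,x_0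 .$$ -/

import Mathlib

open scoped RealInnerProductSpace MeasureTheory

noncomputable section

namespace NearField

/-- `ℝⁿ` with its Euclidean structure. -/
abbrev Space (n : ℕ) : Type := EuclideanSpace ℝ (Fin n)

/-- The unit sphere `S^{n-1}` of `ℝⁿ`. -/
abbrev unitSphere (n : ℕ) : Set (Space n) := Metric.sphere (0 : Space n) 1

/-- The direction `X / |X|`. -/
def dir {n : ℕ} (X : Space n) : Space n := ‖X‖⁻¹ • X

/-- The polar radius `ρ(x, Y, b)` of the Descartes oval `{X : |X| + κ |X - Y| = b}`. The same formula
is used for `x` off the unit sphere. -/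
def ovalRadius {n : ℕ} (κ : ℝ) (x Y : Space n) (b : ℝ) : ℝ :=
  (b - κ ^ 2 * ⟪x, Y⟫ -
      √((b - κ ^ 2 * ⟪x, Y⟫) ^ 2 - (1 - κ ^ 2) * (b ^ 2 - κ ^ 2 * ‖Y‖ ^ 2))) / (1 - κ ^ 2)

/-- `h(x, Y, X₀)`: polar radius of the oval with focus `Y` through the point `X₀`. -/
def h {n : ℕ} (κ : ℝ) (x Y X₀ : Space n) : ℝ :=
  ovalRadius κ x Y (‖X₀‖ + κ * ‖X₀ - Y‖)

/-- `Γ_{c₁c₂} = {r x : x ∈ Ω, c₁ ≤ r ≤ c₂}`. -/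
def Gam {n : ℕ} (c₁ c₂ : ℝ) (Ω : Set (Space n)) : Set (Space n) :=
  {X | ∃ x ∈ Ω, ∃ r ∈ Set.Icc c₁ c₂, X = r • x}

/-- `X/|X| · (Y - X)/|Y - X| ≥ κ`, the condition for refraction at `X` into `Y`. The points `Y` form
the cone `C_X` with vertex `X` (the vertex itself is left out). -/
def refractionCone {n : ℕ} (κ : ℝ) (X : Space n) : Set (Space n) :=
  {Y | κ ≤ ⟪dir X, dir (Y - X)⟫}

/-- The point `m_λ = (1 - λ) m̄ + λ m̂` of the chord. -/
def chord {n : ℕ} (mbar mhat : Space n) (l : ℝ) : Space n := (1 - l) • mbar + l • mhat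

/-- `β(λ)`: the smaller root `β` of `|x₀/κ + β ξ| = 1` with `ξ = m_λ - x₀/κ`. -/
def beta {n : ℕ} (κ : ℝ) (x₀ mbar mhat : Space n) (l : ℝ) : ℝ :=
  let ξ : Space n := chord mbar mhat l - κ⁻¹ • x₀
  (-⟪x₀, ξ⟫ - √(⟪x₀, ξ⟫ ^ 2 - (1 - κ ^ 2) * ‖ξ‖ ^ 2)) / (κ * ‖ξ‖ ^ 2)

/-- `m(λ) = x₀/κ + β(λ) (m_λ - x₀/κ)`, the parametrization of the curve `[m̄, m̂]_{x₀}` in which the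
triangle with vertices `m̄`, `m̂`, `x₀/κ` meets the unit sphere. -/
def curvePt {n : ℕ} (κ : ℝ) (x₀ mbar mhat : Space n) (l : ℝ) : Space n :=
  κ⁻¹ • x₀ + beta κ x₀ mbar mhat l • (chord mbar mhat l - κ⁻¹ • x₀)

/-- The curve `[m̄, m̂]_{x₀}`. -/
def curve {n : ℕ} (κ : ℝ) (x₀ mbar mhat : Space n) : Set (Space n) :=
  curvePt κ x₀ mbar mhat '' Set.Icc 0 1

/-- The point `Y(λ) = X₀ + s_{X₀}(m(λ)) m(λ)` of the curve `[Ȳ, Ŷ]_{X₀}` on the target. -/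
def targetCurvePt {n : ℕ} (κ : ℝ) (s : Space n → Space n → ℝ) (X₀ Ybar Yhat : Space n) (l : ℝ) :
    Space n :=
  let m : Space n := curvePt κ (dir X₀) (dir (Ybar - X₀)) (dir (Yhat - X₀)) l
  X₀ + s X₀ m • m

/-- Visibility of the target `T` from `Γ_{c₁c₂}`: `T ⊆ ⋂ C_X`, and from each `X ∈ Γ_{c₁c₂}` the target
is a polar graph `s_X` over a set `E(X)` of directions which is convex with respect to the curves
`[m̄, m̂]_x`, the functions `s_X` being uniformly Lipschitz. -/
structure HypA {n : ℕ} (κ c₁ c₂ : ℝ) (Ω T : Set (Space n)) (E : Space n → Set (Space n))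
    (s : Space n → Space n → ℝ) : Prop where
  subset_cone : ∀ X ∈ Gam c₁ c₂ Ω, T ⊆ refractionCone κ X
  directions : ∀ X ∈ Gam c₁ c₂ Ω, E X ⊆ {m | m ∈ unitSphere n ∧ κ ≤ ⟪m, dir X⟫}
  cont : ∀ X ∈ Gam c₁ c₂ Ω, ContinuousOn (s X) (E X)
  pos : ∀ X ∈ Gam c₁ c₂ Ω, ∀ m ∈ E X, 0 < s X m
  graph : ∀ X ∈ Gam c₁ c₂ Ω, T = (fun m => X + s X m • m) '' E X
  convex : ∀ X ∈ Gam c₁ c₂ Ω, ∀ mbar ∈ E X, ∀ mhat ∈ E X, curve κ (dir X) mbar mhat ⊆ E X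
  lipschitz : ∃ C > 0, ∀ X ∈ Gam c₁ c₂ Ω, ∀ m₁ ∈ E X, ∀ m₂ ∈ E X,
    |s X m₁ - s X m₂| ≤ C * ‖m₁ - m₂‖

/-- The target is far from `Γ_{c₁c₂}`. -/
def HypB {n : ℕ} (κ c₁ c₂ : ℝ) (Ω T : Set (Space n)) : Prop :=
  ∀ X ∈ Gam c₁ c₂ Ω, ∀ Y ∈ T, ‖X‖ / ‖Y - X‖ ≤ κ * (√(1 + ((1 + κ) ^ 2)⁻¹) - 1)

/-- The concavity condition on the functions `s_X`. -/
def HypC {n : ℕ} (κ c₁ c₂ : ℝ) (Ω : Set (Space n)) (E : Space n → Set (Space n))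
    (s : Space n → Space n → ℝ) : Prop :=
  ∃ μ : ℝ, 0 ≤ μ ∧ μ < κ ∧
    ∀ X₀ ∈ Gam c₁ c₂ Ω, ∀ mbar ∈ E X₀, ∀ mhat ∈ E X₀, ∀ l ∈ Set.Icc (0 : ℝ) 1,
      (1 - l) * beta κ (dir X₀) mbar mhat l * (1 / s X₀ mbar + μ / ‖X₀‖) +
          l * beta κ (dir X₀) mbar mhat l * (1 / s X₀ mhat + μ / ‖X₀‖) ≤
        1 / s X₀ (curvePt κ (dir X₀) mbar mhat l) + μ / ‖X₀‖

/-- The lower bound for the measure of the part of the target near the middle portion of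
`[Ȳ, Ŷ]_{X₀}`. -/
def HypD {n : ℕ} (κ c₁ c₂ : ℝ) (Ω T : Set (Space n)) (s : Space n → Space n → ℝ) : Prop :=
  ∃ μ₀ > 0, ∃ C > 0, ∀ X₀ ∈ Gam c₁ c₂ Ω, ∀ Ybar ∈ T, ∀ Yhat ∈ T, ∀ μ : ℝ, 0 < μ → μ ≤ μ₀ →
    ENNReal.ofReal (C * μ ^ (n - 2) * ‖Ybar - Yhat‖) ≤
      μH[(n : ℝ) - 1]
        (Metric.thickening μ (targetCurvePt κ s X₀ Ybar Yhat '' Set.Icc (1 / 4) (3 / 4)) ∩ T)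

/-- `∂u(x₀)`: the points `Y` of the target whose oval through `X₀ = u(x₀) x₀` supports `u` on `Ω`. -/
def subdiff {n : ℕ} (κ : ℝ) (Ω T : Set (Space n)) (u : Space n → ℝ) (x₀ : Space n) :
    Set (Space n) :=
  {Y | Y ∈ T ∧ ∀ x ∈ Ω, h κ x Y (u x₀ • x₀) ≤ u x}

/-- `u : Ω → [c₁, c₂]` is a refractor from `Ω` to `T`. Only the values of `u` on `Ω` matter. -/
def IsRefractor {n : ℕ} (κ c₁ c₂ : ℝ) (Ω T : Set (Space n)) (u : Space n → ℝ) : Prop :=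
  (∀ x ∈ Ω, u x ∈ Set.Icc c₁ c₂) ∧ ∀ x₀ ∈ Ω, (subdiff κ Ω T u x₀).Nonempty

/-- `H^{n-1}(∂u(B_σ ∩ S^{n-1})) ≤ C σ^{n-1}` whenever `B_σ ∩ S^{n-1} ⊆ Ω`. -/
def MeasureBound {n : ℕ} (κ : ℝ) (Ω T : Set (Space n)) (u : Space n → ℝ) : Prop :=
  ∃ C : ℝ, ∀ z ∈ unitSphere n, ∀ σ : ℝ, 0 < σ → Metric.ball z σ ∩ unitSphere n ⊆ Ω →
    μH[(n : ℝ) - 1] (⋃ x ∈ Metric.ball z σ ∩ unitSphere n, subdiff κ Ω T u x) ≤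
      ENNReal.ofReal (C * σ ^ (n - 1))

/-- The extension `ũ(X) = u(X/|X|)`, homogeneous of degree zero. -/
def radialExt {n : ℕ} (u : Space n → ℝ) (X : Space n) : ℝ := u (dir X)

/-- `u ∈ C^{1,α}_loc(Ω)` for a relatively open set `Ω` of the sphere: `u` is differentiable on `Ω` and
its tangential gradient, which at a point of the sphere is the gradient of the extension `ũ`, is
Hölder continuous with exponent `α` on each compact subset of `Ω`. -/
def IsC1HolderLoc {n : ℕ} (α : ℝ) (Ω : Set (Space n)) (u : Space n → ℝ) : Prop :=
  (∀ x ∈ Ω, DifferentiableAt ℝ (radialExt u) x) ∧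
    ∀ K ⊆ Ω, IsCompact K → ∃ C : ℝ, ∀ x ∈ K, ∀ y ∈ K,
      ‖gradient (radialExt u) x - gradient (radialExt u) y‖ ≤ C * ‖x - y‖ ^ α

end NearField

end

open scoped RealInnerProductSpace MeasureTheory

noncomputable section

namespace NearField

/-! A target point `Y` belongs to `∂u(x₀)` exactly when the graph of `u` minimizes the optical
length to `Y` above `x₀` (`mem_subdiff_iff`). The whole argument reads off this minimization.

The engine is `exists_maximum_principle`. Put `d = |X| - |X₀|`, `w = |X - X₀|`, `A = (κ²w² - d²)/2`.
Cleared of square roots, the increment of optical length from `X₀` to `X` towards `X₀ + t m` has the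
sign of `A/t - κ²⟨m, X - X₀⟩ + κd`. Writing `κd = κ⟨x₀, X - X₀⟩ + κ(d - ⟨x₀, X - X₀⟩)`, this is
`A/t`, plus a linear function of `m - x₀/κ`, plus a term independent of `m` that is nonnegative by
convexity of the norm. Along `[m̄, m̂]` the vector `m(λ) - x₀/κ` is `β(λ)` times a convex
combination of its end values. So H.C controls `A/t` when `A ≥ 0`, a fraction `1 - β` of the
convexity term is left over, and `μ < κ` keeps it from being used up. For middle `λ` the result is a
gain of order `|Ȳ - Ŷ|² w²`.

Take `Ȳ ∈ ∂u(x̄)`, `Ŷ ∈ ∂u(x̂)`, `δ = |Ȳ - Ŷ|`. Above `x̄` the graph minimizes the length to `Ȳ`,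
and that to `Ŷ` up to `O(|x̄ - x̂| δ)` (`exists_mixed_opticalLength_le`). If `σ²δ ≥ C₁|x̄ - x̂|`,
the gain at distance at least `σ` beats this error and survives moving the target by `aδ²σ`, so the
targets near the middle of the curve come from `∂u` of a ball of radius `Kσ`
(`exists_thickening_subset`). H.D and the measure bound then give `(δ²σ)^(n-2) δ ≲ σ^(n-1)`, that is
`δ^(2n-3) ≲ σ`, and `σ² ~ |x̄ - x̂|/δ` yields `δ^(4n-5) ≲ |x̄ - x̂|`.

Finally, Hölder continuity of the refractor map puts `u` within `O(|y - x₀|^(1+α))` of its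
supporting oval, so both have the same tangential gradient (`IsRefractor.hasGradientAt_radialExt`).
That gradient is a Lipschitz function of position, radius and focus. -/

/-- The optical length `|X| + κ |X - Y|`, whose level sets are the Descartes ovals with focus `Y`. -/
def opticalLength {n : ℕ} (κ : ℝ) (Y X : Space n) : ℝ := ‖X‖ + κ * ‖X - Y‖

/-- The graph point `u(x) x`. -/
def graphPt {n : ℕ} (u : Space n → ℝ) (x : Space n) : Space n := u x • x

/-! ### Ovals, optical length and its mixed differences -/

/-- A ray leaves the oval exactly where the optical length exceeds `b`. -/
theorem ovalRadius_le_iff {n : ℕ} {κ : ℝ} (hκ0 : 0 < κ) (hκ1 : κ < 1) {x : Space n} (hx : ‖x‖ = 1)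
    (Y : Space n) (b t : ℝ) : ovalRadius κ x Y b ≤ t ↔ b ≤ t + κ * ‖t • x - Y‖ := by
  have hk : 0 < 1 - κ ^ 2 := by nlinarith
  have hnorm : ∀ r : ℝ, ‖r • x - Y‖ ^ 2 = r ^ 2 - 2 * r * ⟪x, Y⟫ + ‖Y‖ ^ 2 := by
    intro r
    rw [norm_sub_sq_real, norm_smul, hx, inner_smul_left, Real.norm_eq_abs, mul_one, sq_abs]
    simp; ring
  have h1 := hnorm t
  have h2 := hnorm b
  have hr := norm_nonneg (t • x - Y)
  have hr' := norm_nonneg (b • x - Y)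
  set r := ‖t • x - Y‖
  set r' := ‖b • x - Y‖
  set B := b - κ ^ 2 * ⟪x, Y⟫ with hB
  set D := B ^ 2 - (1 - κ ^ 2) * (b ^ 2 - κ ^ 2 * ‖Y‖ ^ 2) with hD
  -- Squaring `b - t = κ|t x - Y|` gives a quadratic in `t` with discriminant `4D`. Its value at `t
  -- = b` is `-(κ r')² ≤ 0`, so `D ≥ 0` and `b` lies between the roots: the smaller root is the one
  -- with `t ≤ b`, hence not spurious.
  have hDb : D = ((1 - κ ^ 2) * b - B) ^ 2 + (1 - κ ^ 2) * (κ * r') ^ 2 := by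
    rw [mul_pow, h2, hD, hB]; ring
  have hDt : D = ((1 - κ ^ 2) * t - B) ^ 2 + (1 - κ ^ 2) * ((κ * r) ^ 2 - (b - t) ^ 2) := by
    rw [mul_pow, h1, hD, hB]; ring
  have hDb' : ((1 - κ ^ 2) * b - B) ^ 2 ≤ D := by rw [hDb]; nlinarith [sq_nonneg (κ * r')]
  have hov : ovalRadius κ x Y b ≤ t ↔ B - (1 - κ ^ 2) * t ≤ √D := by
    unfold ovalRadius
    rw [div_le_iff₀ hk]
    constructor <;> intro h <;> linarith
  rw [hov]
  have hκr : 0 ≤ κ * r := by positivity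
  constructor
  · intro h
    by_cases htb : b ≤ t
    · linarith
    push Not at htb
    have hsq : ((1 - κ ^ 2) * t - B) ^ 2 ≤ D := by
      by_cases hw : (1 - κ ^ 2) * t ≤ B
      · have h0 : 0 ≤ B - (1 - κ ^ 2) * t := by linarith
        have hD0 : 0 ≤ D := le_trans (sq_nonneg _) hDb'
        have := (Real.le_sqrt h0 hD0).1 h
        rwa [sub_sq_comm]
      · push Not at hw
        have h3 : (1 - κ ^ 2) * t < (1 - κ ^ 2) * b := mul_lt_mul_of_pos_left htb hk
        exact (pow_le_pow_left₀ (by linarith) (by linarith) 2).trans hDb'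
    have : (b - t) ^ 2 ≤ (κ * r) ^ 2 := by
      by_contra hc
      push Not at hc
      linarith [mul_pos hk (sub_pos.2 hc)]
    linarith [(abs_le.1 (abs_le_of_sq_le_sq this hκr)).2]
  · intro h
    by_cases hw : B ≤ (1 - κ ^ 2) * t
    · linarith [Real.sqrt_nonneg D]
    push Not at hw
    apply Real.le_sqrt_of_sq_le
    by_cases htb : t ≤ b
    · have : (b - t) ^ 2 ≤ (κ * r) ^ 2 := pow_le_pow_left₀ (by linarith) (by linarith) 2
      linarith [mul_nonneg hk.le (sub_nonneg.2 this), sub_sq_comm B ((1 - κ ^ 2) * t)]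
    · push Not at htb
      have h3 : (1 - κ ^ 2) * b < (1 - κ ^ 2) * t := mul_lt_mul_of_pos_left htb hk
      have h4 : (B - (1 - κ ^ 2) * t) ^ 2 ≤ (B - (1 - κ ^ 2) * b) ^ 2 :=
        pow_le_pow_left₀ (by linarith) (by linarith) 2
      linarith [sub_sq_comm B ((1 - κ ^ 2) * b)]

/-- A point `Y` of the target belongs to `∂u(x₀)` exactly when the graph minimizes the optical length
to `Y` above `x₀`. -/
theorem mem_subdiff_iff {n : ℕ} {κ : ℝ} (hκ0 : 0 < κ) (hκ1 : κ < 1) {Ω T : Set (Space n)}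
    (hΩ : Ω ⊆ unitSphere n) {u : Space n → ℝ} (hu : ∀ x ∈ Ω, 0 ≤ u x) {x₀ Y : Space n} :
    Y ∈ subdiff κ Ω T u x₀ ↔ Y ∈ T ∧ ∀ x ∈ Ω,
      opticalLength κ Y (graphPt u x₀) ≤ opticalLength κ Y (graphPt u x) := by
  refine and_congr_right fun _ => forall₂_congr fun x hx => ?_
  have hx1 : ‖x‖ = 1 := by simpa using hΩ hx
  unfold h
  rw [ovalRadius_le_iff hκ0 hκ1 hx1]
  simp only [opticalLength, graphPt]
  rw [norm_smul (u x) x, hx1, Real.norm_of_nonneg (hu x hx), mul_one]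

/-- Along a ray the optical length increases with slope at least `1 - κ`. -/
theorem slope_le_opticalLength_sub {n : ℕ} {κ : ℝ} (hκ0 : 0 < κ) {x : Space n} (hx : ‖x‖ = 1)
    (Y : Space n) {r t : ℝ} (hrt : r ≤ t) :
    (1 - κ) * (t - r) ≤ (t + κ * ‖t • x - Y‖) - (r + κ * ‖r • x - Y‖) := by
  have h1 : ‖r • x - Y‖ ≤ ‖t • x - Y‖ + (t - r) := by
    have : r • x - Y = (t • x - Y) - (t - r) • x := by rw [sub_smul]; abel
    rw [this]
    refine (norm_sub_le _ _).trans ?_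
    rw [norm_smul, hx, Real.norm_of_nonneg (by linarith), mul_one]
  nlinarith

/-- The point of the oval on the ray through `x` has optical length `b`. -/
theorem ovalRadius_spec {n : ℕ} {κ : ℝ} (hκ0 : 0 < κ) (hκ1 : κ < 1) {x : Space n} (hx : ‖x‖ = 1)
    (Y : Space n) (b : ℝ) :
    ovalRadius κ x Y b + κ * ‖ovalRadius κ x Y b • x - Y‖ = b := by
  set t := ovalRadius κ x Y b with ht
  have h1 : b ≤ t + κ * ‖t • x - Y‖ := (ovalRadius_le_iff hκ0 hκ1 hx Y b t).1 le_rfl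
  by_contra hne
  have hlt : b < t + κ * ‖t • x - Y‖ := lt_of_le_of_ne h1 (Ne.symm hne)
  -- Optical length has slope at most `1 + κ` along the ray, so stepping back by `e` still leaves it
  -- at least `b`, against the minimality of `t`.
  set e := (t + κ * ‖t • x - Y‖ - b) / (1 + κ) with he
  have he0 : 0 < e := div_pos (by linarith) (by linarith)
  have he1 : e * (1 + κ) = t + κ * ‖t • x - Y‖ - b := by rw [he]; field_simp
  have h2 : ‖t • x - Y‖ ≤ ‖(t - e) • x - Y‖ + e := by
    have : t • x - Y = ((t - e) • x - Y) + e • x := by rw [sub_smul]; abel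
    rw [this]
    refine (norm_add_le _ _).trans ?_
    rw [norm_smul, hx, Real.norm_of_nonneg he0.le, mul_one]
  have h3 : b ≤ (t - e) + κ * ‖(t - e) • x - Y‖ := by nlinarith
  have := (ovalRadius_le_iff hκ0 hκ1 hx Y b (t - e)).2 h3
  linarith

/-- Mixed second difference of the distance function. -/
theorem abs_mixed_dist_le {V : Type*} [NormedAddCommGroup V] [InnerProductSpace ℝ V]
    {X X' Y Y' : V} {s₀ : ℝ} (hs : 0 < s₀) (h1 : s₀ ≤ ‖X - Y‖) (h2 : s₀ ≤ ‖X' - Y‖)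
    (h3 : s₀ ≤ ‖X - Y'‖) (h4 : s₀ ≤ ‖X' - Y'‖) :
    |(‖X - Y‖ - ‖X' - Y‖) - (‖X - Y'‖ - ‖X' - Y'‖)| ≤ 2 / s₀ * ‖X - X'‖ * ‖Y - Y'‖ := by
  -- Difference of squares: the increment becomes an inner product with `X - X'`, so only the second
  -- factor has to be compared for two values of `Z`.
  have key : ∀ Z : V, 0 < ‖X - Z‖ + ‖X' - Z‖ → ‖X - Z‖ - ‖X' - Z‖ =
      ⟪X - X', (‖X - Z‖ + ‖X' - Z‖)⁻¹ • ((X - Z) + (X' - Z))⟫ := by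
    intro Z hZ
    rw [inner_smul_right, eq_inv_mul_iff_mul_eq₀ hZ.ne']
    have e : X - X' = (X - Z) - (X' - Z) := by abel
    rw [e, inner_sub_left, inner_add_right, inner_add_right, real_inner_comm (X - Z) (X' - Z),
      real_inner_self_eq_norm_sq, real_inner_self_eq_norm_sq]
    ring
  have hD : 2 * s₀ ≤ ‖X - Y‖ + ‖X' - Y‖ := by linarith
  have hD' : 2 * s₀ ≤ ‖X - Y'‖ + ‖X' - Y'‖ := by linarith
  rw [key Y (by linarith), key Y' (by linarith), ← inner_sub_right]
  set a := ‖X - Y‖ + ‖X' - Y‖ with ha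
  set a' := ‖X - Y'‖ + ‖X' - Y'‖ with ha'
  have ha0 : 0 < a := by linarith
  have ha0' : 0 < a' := by linarith
  have haa : |a' - a| ≤ 2 * ‖Y - Y'‖ := by
    have e1 := abs_norm_sub_norm_le (X - Y') (X - Y)
    have e2 := abs_norm_sub_norm_le (X' - Y') (X' - Y)
    have f1 : X - Y' - (X - Y) = Y - Y' := by abel
    have f2 : X' - Y' - (X' - Y) = Y - Y' := by abel
    rw [f1] at e1
    rw [f2] at e2
    have : a' - a = (‖X - Y'‖ - ‖X - Y‖) + (‖X' - Y'‖ - ‖X' - Y‖) := by rw [ha, ha']; ring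
    rw [this]
    exact (abs_add_le _ _).trans (by linarith)
  have hdecomp : a⁻¹ • ((X - Y) + (X' - Y)) - a'⁻¹ • ((X - Y') + (X' - Y')) =
      a⁻¹ • ((-2 : ℝ) • (Y - Y')) + (a⁻¹ * a'⁻¹ * (a' - a)) • ((X - Y') + (X' - Y')) := by
    have e1 : a⁻¹ * a'⁻¹ * (a' - a) = a⁻¹ - a'⁻¹ := by field_simp
    rw [e1, sub_smul]
    module
  have hN : ‖(X - Y') + (X' - Y')‖ ≤ a' := norm_add_le _ _
  have hbound : ‖a⁻¹ • ((X - Y) + (X' - Y)) - a'⁻¹ • ((X - Y') + (X' - Y'))‖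
      ≤ 2 / s₀ * ‖Y - Y'‖ := by
    rw [hdecomp]
    refine (norm_add_le _ _).trans ?_
    rw [norm_smul, norm_smul, norm_smul, norm_mul, norm_mul, norm_inv, norm_inv,
      Real.norm_of_nonneg ha0.le, Real.norm_of_nonneg ha0'.le, Real.norm_eq_abs (a' - a)]
    have e2 : a⁻¹ * a'⁻¹ * |a' - a| * ‖(X - Y') + (X' - Y')‖ ≤ a⁻¹ * (2 * ‖Y - Y'‖) := by
      calc a⁻¹ * a'⁻¹ * |a' - a| * ‖(X - Y') + (X' - Y')‖
          ≤ a⁻¹ * a'⁻¹ * (2 * ‖Y - Y'‖) * a' := by gcongr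
        _ = a⁻¹ * (2 * ‖Y - Y'‖) := by field_simp
    have e3 : a⁻¹ ≤ (2 * s₀)⁻¹ := inv_anti₀ (by positivity) hD
    have e4 : ‖(-2 : ℝ)‖ = 2 := by norm_num
    rw [e4]
    calc a⁻¹ * (2 * ‖Y - Y'‖) + a⁻¹ * a'⁻¹ * |a' - a| * ‖(X - Y') + (X' - Y')‖
        ≤ a⁻¹ * (4 * ‖Y - Y'‖) := by linarith
      _ ≤ (2 * s₀)⁻¹ * (4 * ‖Y - Y'‖) := by gcongr
      _ = 2 / s₀ * ‖Y - Y'‖ := by field_simp; ring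
  refine (abs_real_inner_le_norm _ _).trans ?_
  calc _ ≤ ‖X - X'‖ * (2 / s₀ * ‖Y - Y'‖) := by gcongr
    _ = _ := by ring

/-! ### Geometry of the curve `[m̄, m̂]` -/

theorem norm_chord_sq {n : ℕ} {mbar mhat : Space n} (h1 : ‖mbar‖ = 1) (h2 : ‖mhat‖ = 1) (l : ℝ) :
    ‖chord mbar mhat l‖ ^ 2 = 1 - l * (1 - l) * ‖mbar - mhat‖ ^ 2 := by
  unfold chord
  rw [norm_add_sq_real, norm_sub_sq_real, norm_smul, norm_smul, inner_smul_left, inner_smul_right,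
    h1, h2, mul_one, mul_one, Real.norm_eq_abs, Real.norm_eq_abs, sq_abs, sq_abs]
  simp
  ring

theorem chord_sub_left {n : ℕ} (mbar mhat : Space n) (l : ℝ) :
    chord mbar mhat l - mbar = -l • (mbar - mhat) := by
  unfold chord; module

theorem chord_sub_right {n : ℕ} (mbar mhat : Space n) (l : ℝ) :
    chord mbar mhat l - mhat = (1 - l) • (mbar - mhat) := by
  unfold chord; module

theorem curvePt_sub_chord {n : ℕ} (κ : ℝ) (x₀ mbar mhat : Space n) (l : ℝ) :
    curvePt κ x₀ mbar mhat l - chord mbar mhat l =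
      -(1 - beta κ x₀ mbar mhat l) • (chord mbar mhat l - κ⁻¹ • x₀) := by
  unfold curvePt; module

/-- Bounds for the smaller root `β` of `κ N² β² + 2 a β + (1 - κ²) / κ = 0`, where the value of the
polynomial at `1` is `-κ t` and the midpoint of the roots is at least `1`. -/
theorem small_root_bounds {κ N a t τ β : ℝ} (hκ0 : 0 < κ) (hκ1 : κ < 1) (hτ : 0 ≤ τ) (hN0 : 0 < N)
    (hax : |a| ≤ N) (hcx : κ ^ 2 ≤ κ * a + 1) (hcq : κ ^ 2 * N ^ 2 + 2 * κ * a + 1 = κ ^ 2 * (1 - t))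
    (ht0 : 0 ≤ t) (htτ : t ≤ τ ^ 2) (hNlow : 1 - κ ≤ κ * N) (hNup : κ * N ≤ 1 + κ)
    (hβ : β = (-a - √(a ^ 2 - (1 - κ ^ 2) * N ^ 2)) / (κ * N ^ 2)) :
    0 ≤ β ∧ β ≤ 1 ∧ κ / (2 * (1 + κ)) * t ≤ 1 - β ∧ (1 - β) * N ≤ τ ∧
      1 - β ≤ κ / (1 - κ) * τ := by
  have hκN : 0 < κ * N ^ 2 := by positivity
  have hkt : 0 ≤ κ ^ 2 * t := by positivity
  have hκa : κ * a ≤ 0 := by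
    have : 0 < κ ^ 2 * N ^ 2 := by positivity
    nlinarith
  -- After scaling by `κN²`, `z` is the distance from `1` to the midpoint of the roots and `w` is
  -- half their gap, so `1 - β` corresponds to `w - z`.
  obtain ⟨z, hz⟩ : ∃ z, z = -(κ * N ^ 2 + a) := ⟨_, rfl⟩
  have hz0 : 0 ≤ z := by
    have : 0 ≤ κ * z := by
      have e : κ * z = -(κ ^ 2 * N ^ 2) - κ * a := by rw [hz]; ring
      linarith
    exact nonneg_of_mul_nonneg_right this hκ0
  have hdisc : a ^ 2 - (1 - κ ^ 2) * N ^ 2 = z ^ 2 + κ ^ 2 * t * N ^ 2 := by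
    have : 1 - κ ^ 2 = -(κ ^ 2 * N ^ 2) - 2 * κ * a - κ ^ 2 * t := by linarith
    rw [this, hz]; ring
  obtain ⟨w, hw⟩ : ∃ w, w = √(a ^ 2 - (1 - κ ^ 2) * N ^ 2) := ⟨_, rfl⟩
  have hw0 : 0 ≤ w := hw ▸ Real.sqrt_nonneg _
  have hkt' : 0 ≤ κ ^ 2 * t * N ^ 2 := by positivity
  have hw2 : w ^ 2 = z ^ 2 + κ ^ 2 * t * N ^ 2 := by
    rw [hw, Real.sq_sqrt (by rw [hdisc]; positivity), hdisc]
  have hk : 0 < 1 - κ ^ 2 := by nlinarith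
  have hwN : w ≤ κ * N := by
    refine (abs_le_of_sq_le_sq' ?_ (by positivity)).2
    have h3 : a ^ 2 ≤ N ^ 2 := sq_le_sq' (abs_le.1 hax).1 (abs_le.1 hax).2
    rw [hw2, ← hdisc]; linarith
  have hzw : z ≤ w := by
    refine (abs_le_of_sq_le_sq' ?_ hw0).2
    rw [hw2]; linarith
  rw [← hw] at hβ
  have hβ0 : β * (κ * N ^ 2) = -a - w := by rw [hβ]; field_simp
  have hβ' : (1 - β) * (κ * N ^ 2) = w - z := by rw [sub_mul, hβ0, hz]; ring
  -- Both bounds on `w - z` come from this product: from above by `w - z ≤ w + z`, from below by `w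
  -- + z ≤ 2w ≤ 2κN`.
  have hprod : (w - z) * (w + z) = κ ^ 2 * t * N ^ 2 := by linear_combination hw2
  have hβ1 : 0 ≤ 1 - β := by
    refine nonneg_of_mul_nonneg_left ?_ hκN
    rw [hβ']; linarith
  have hup : (1 - β) * N ≤ τ := by
    have h3 : (w - z) ^ 2 ≤ (κ * τ * N) ^ 2 := by
      have h5 : κ ^ 2 * t * N ^ 2 ≤ κ ^ 2 * τ ^ 2 * N ^ 2 := by gcongr
      have h6 : (w - z) ^ 2 ≤ (w - z) * (w + z) := by
        rw [sq]; exact mul_le_mul_of_nonneg_left (by linarith) (by linarith)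
      calc _ ≤ _ := h6
        _ = _ := hprod
        _ ≤ _ := h5
        _ = _ := by ring
    have h4 := (abs_le_of_sq_le_sq' h3 (by positivity)).2
    rw [← hβ'] at h4
    have : κ * N * ((1 - β) * N) ≤ κ * N * τ := by linarith
    exact le_of_mul_le_mul_left this (by positivity)
  refine ⟨?_, by linarith, ?_, hup, ?_⟩
  · have ha0 : a ≤ 0 := nonpos_of_mul_nonpos_right hκa hκ0
    have hwa : w ≤ -a := by
      refine (abs_le_of_sq_le_sq' ?_ (by linarith)).2
      rw [hw2, ← hdisc, neg_sq]
      linarith [mul_nonneg hk.le (sq_nonneg N)]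
    refine nonneg_of_mul_nonneg_left ?_ hκN
    rw [hβ0]; linarith
  · have h3 : t ≤ (1 - β) * (2 * N) := by
      have : κ ^ 2 * N ^ 2 * t ≤ κ ^ 2 * N ^ 2 * ((1 - β) * (2 * N)) := by
        calc κ ^ 2 * N ^ 2 * t = (w - z) * (w + z) := by rw [hprod]; ring
          _ ≤ (w - z) * (2 * (κ * N)) := by
              apply mul_le_mul_of_nonneg_left <;> linarith
          _ = _ := by rw [← hβ']; ring
      exact le_of_mul_le_mul_left this (by positivity)
    rw [div_mul_eq_mul_div, div_le_iff₀ (by positivity)]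
    nlinarith [mul_le_mul_of_nonneg_left hNup hβ1, mul_le_mul_of_nonneg_left h3 hκ0.le]
  · rw [div_mul_eq_mul_div, le_div_iff₀ (by linarith)]
    nlinarith [mul_le_mul_of_nonneg_left hNlow hβ1, mul_le_mul_of_nonneg_left hup hκ0.le]

/-- The chord point lies inside the sphere, with squared norm short of `1` by `l(1-l)|m̄ - m̂|²`, so
the ray from `x₀/κ` meets the sphere before reaching it. The cone condition `κ ≤ ⟨m, x₀⟩` puts the
midpoint of the two roots at or beyond `1`. The quadratic lower bound on `1 - β` is the source of
the gain in the maximum principle. -/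
theorem beta_bounds {n : ℕ} {κ : ℝ} (hκ0 : 0 < κ) (hκ1 : κ < 1) {x₀ mbar mhat : Space n}
    (hx₀ : ‖x₀‖ = 1) (h1 : ‖mbar‖ = 1) (h2 : ‖mhat‖ = 1) (hb : κ ≤ ⟪mbar, x₀⟫)
    (hh : κ ≤ ⟪mhat, x₀⟫) {l : ℝ} (hl : l ∈ Set.Icc (0 : ℝ) 1) :
    0 ≤ beta κ x₀ mbar mhat l ∧ beta κ x₀ mbar mhat l ≤ 1 ∧
      κ / (2 * (1 + κ)) * (l * (1 - l) * ‖mbar - mhat‖ ^ 2) ≤ 1 - beta κ x₀ mbar mhat l ∧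
      (1 - beta κ x₀ mbar mhat l) * ‖chord mbar mhat l - κ⁻¹ • x₀‖ ≤ ‖mbar - mhat‖ ∧
      1 - beta κ x₀ mbar mhat l ≤ κ / (1 - κ) * ‖mbar - mhat‖ := by
  obtain ⟨hl0, hl1⟩ := hl
  have hc := norm_chord_sq h1 h2 l
  have hτ := norm_nonneg (mbar - mhat)
  have hcx : κ ≤ ⟪chord mbar mhat l, x₀⟫ := by
    have : ⟪chord mbar mhat l, x₀⟫ = (1 - l) * ⟪mbar, x₀⟫ + l * ⟪mhat, x₀⟫ := by
      unfold chord
      rw [inner_add_left, inner_smul_left, inner_smul_left]; simp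
    rw [this]; nlinarith
  have hbeta : beta κ x₀ mbar mhat l =
      (-⟪x₀, chord mbar mhat l - κ⁻¹ • x₀⟫ - √(⟪x₀, chord mbar mhat l - κ⁻¹ • x₀⟫ ^ 2 -
        (1 - κ ^ 2) * ‖chord mbar mhat l - κ⁻¹ • x₀‖ ^ 2)) /
        (κ * ‖chord mbar mhat l - κ⁻¹ • x₀‖ ^ 2) := rfl
  have hcle : ‖chord mbar mhat l‖ ^ 2 ≤ 1 := by
    rw [hc]
    have : 0 ≤ l * (1 - l) * ‖mbar - mhat‖ ^ 2 := by
      have : 0 ≤ 1 - l := by linarith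
      positivity
    linarith
  have hcle' : ‖chord mbar mhat l‖ ≤ 1 := by
    nlinarith [norm_nonneg (chord mbar mhat l)]
  have hκx : ‖κ⁻¹ • x₀‖ = κ⁻¹ := by
    rw [norm_smul, hx₀, mul_one, Real.norm_of_nonneg (by positivity)]
  generalize beta κ x₀ mbar mhat l = β at *
  set τ := ‖mbar - mhat‖
  generalize chord mbar mhat l = c at *
  set ξ := c - κ⁻¹ • x₀ with hξ
  have hcξ : c = ξ + κ⁻¹ • x₀ := by rw [hξ]; abel
  have hNlow : κ⁻¹ - 1 ≤ ‖ξ‖ := by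
    have := norm_sub_norm_le (κ⁻¹ • x₀) c
    rw [norm_sub_rev, hκx] at this
    linarith
  have hNup : ‖ξ‖ ≤ κ⁻¹ + 1 := by
    have := norm_sub_le c (κ⁻¹ • x₀)
    rw [hκx] at this
    linarith
  have hκinv : 1 < κ⁻¹ := (one_lt_inv₀ hκ0).2 hκ1
  have hN0 : 0 < ‖ξ‖ := by linarith
  set a := ⟪x₀, ξ⟫ with ha
  have hax : |a| ≤ ‖ξ‖ := by
    have := abs_real_inner_le_norm x₀ ξ
    rwa [hx₀, one_mul] at this
  have hcq : κ ^ 2 * ‖ξ‖ ^ 2 + 2 * κ * a + 1 = κ ^ 2 * ‖c‖ ^ 2 := by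
    rw [hcξ, norm_add_sq_real, hκx, inner_smul_right, real_inner_comm, ← ha]
    field_simp
  have hcx' : κ ^ 2 ≤ κ * a + 1 := by
    rw [hcξ, inner_add_left, inner_smul_left, real_inner_comm, real_inner_self_eq_norm_sq,
      hx₀] at hcx
    simp at hcx
    have := mul_le_mul_of_nonneg_left hcx hκ0.le
    rw [mul_add, mul_inv_cancel₀ hκ0.ne'] at this
    nlinarith
  have hs : 0 ≤ 1 - l := by linarith
  rw [hc] at hcq
  refine small_root_bounds hκ0 hκ1 hτ hN0 hax hcx' hcq (by positivity) ?_ ?_ ?_ hbeta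
  · exact mul_le_of_le_one_left (sq_nonneg _) (by nlinarith)
  · have := mul_le_mul_of_nonneg_left hNlow hκ0.le
    rwa [mul_sub, mul_inv_cancel₀ hκ0.ne', mul_one] at this
  · have := mul_le_mul_of_nonneg_left hNup hκ0.le
    rwa [mul_add, mul_inv_cancel₀ hκ0.ne', mul_one] at this

theorem norm_curvePt_sub_le {n : ℕ} {κ : ℝ} (hκ0 : 0 < κ) (hκ1 : κ < 1) {x₀ mbar mhat : Space n}
    (hx₀ : ‖x₀‖ = 1) (h1 : ‖mbar‖ = 1) (h2 : ‖mhat‖ = 1) (hb : κ ≤ ⟪mbar, x₀⟫)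
    (hh : κ ≤ ⟪mhat, x₀⟫) {l : ℝ} (hl : l ∈ Set.Icc (0 : ℝ) 1) :
    ‖curvePt κ x₀ mbar mhat l - mbar‖ ≤ 2 * ‖mbar - mhat‖ ∧
      ‖curvePt κ x₀ mbar mhat l - mhat‖ ≤ 2 * ‖mbar - mhat‖ := by
  obtain ⟨-, hβ1, -, hup, -⟩ := beta_bounds hκ0 hκ1 hx₀ h1 h2 hb hh hl
  have hcc : ‖curvePt κ x₀ mbar mhat l - chord mbar mhat l‖ ≤ ‖mbar - mhat‖ := by
    rw [curvePt_sub_chord, norm_smul, norm_neg, Real.norm_of_nonneg (by linarith)]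
    exact hup
  have hτ := norm_nonneg (mbar - mhat)
  constructor
  · have e : curvePt κ x₀ mbar mhat l - mbar =
        (curvePt κ x₀ mbar mhat l - chord mbar mhat l) + (chord mbar mhat l - mbar) := by abel
    have h3 : ‖chord mbar mhat l - mbar‖ ≤ ‖mbar - mhat‖ := by
      rw [chord_sub_left, norm_smul, norm_neg, Real.norm_of_nonneg hl.1]
      nlinarith [hl.2]
    rw [e]
    exact (norm_add_le _ _).trans (by linarith)
  · have e : curvePt κ x₀ mbar mhat l - mhat =
        (curvePt κ x₀ mbar mhat l - chord mbar mhat l) + (chord mbar mhat l - mhat) := by abel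
    have h3 : ‖chord mbar mhat l - mhat‖ ≤ ‖mbar - mhat‖ := by
      rw [chord_sub_right, norm_smul, Real.norm_of_nonneg (by linarith [hl.2])]
      nlinarith [hl.1]
    rw [e]
    exact (norm_add_le _ _).trans (by linarith)

/-! ### Directions, and distances from `Γ` to the target -/

theorem norm_dir {n : ℕ} {X : Space n} (hX : X ≠ 0) : ‖dir X‖ = 1 := by
  rw [dir, norm_smul, norm_inv, norm_norm, inv_mul_cancel₀ (norm_ne_zero_iff.2 hX)]

theorem norm_smul_dir {n : ℕ} (X : Space n) : ‖X‖ • dir X = X := by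
  by_cases hX : X = 0
  · simp [dir, hX]
  · rw [dir, smul_smul, mul_inv_cancel₀ (norm_ne_zero_iff.2 hX), one_smul]

theorem dir_smul_unit {n : ℕ} {r : ℝ} (hr : 0 < r) {x : Space n} (hx : ‖x‖ = 1) :
    dir (r • x) = x := by
  rw [dir, norm_smul, hx, mul_one, Real.norm_of_nonneg hr.le, smul_smul, inv_mul_cancel₀ hr.ne',
    one_smul]

theorem norm_mem_of_mem_Gam {n : ℕ} {c₁ c₂ : ℝ} (hc₁ : 0 < c₁) {Ω : Set (Space n)}
    (hΩ : Ω ⊆ unitSphere n) {X : Space n} (hX : X ∈ Gam c₁ c₂ Ω) : ‖X‖ ∈ Set.Icc c₁ c₂ := by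
  obtain ⟨x, hx, r, hr, rfl⟩ := hX
  have hx1 : ‖x‖ = 1 := by simpa using hΩ hx
  rw [norm_smul, hx1, mul_one, Real.norm_of_nonneg (hc₁.le.trans hr.1)]
  exact hr

theorem smul_dir_mem_Gam {n : ℕ} {c₁ c₂ : ℝ} (hc₁ : 0 < c₁) {Ω : Set (Space n)}
    (hΩ : Ω ⊆ unitSphere n) {X : Space n} (hX : X ∈ Gam c₁ c₂ Ω) {r : ℝ} (hr : r ∈ Set.Icc c₁ c₂) :
    r • dir X ∈ Gam c₁ c₂ Ω := by
  obtain ⟨x, hx, t, ht, rfl⟩ := hX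
  have hx1 : ‖x‖ = 1 := by simpa using hΩ hx
  rw [dir_smul_unit (hc₁.trans_le ht.1) hx1]
  exact ⟨x, hx, r, hr, rfl⟩

section Target

variable {n : ℕ} {κ c₁ c₂ : ℝ} {Ω T : Set (Space n)} {E : Space n → Set (Space n)}
  {s : Space n → Space n → ℝ}

/-- The polar description of a point of the target. -/
theorem HypA.polar (hA : HypA κ c₁ c₂ Ω T E s) {X Y : Space n} (hX : X ∈ Gam c₁ c₂ Ω) (hY : Y ∈ T) :
    dir (Y - X) ∈ E X ∧ s X (dir (Y - X)) = ‖Y - X‖ ∧ 0 < ‖Y - X‖ := by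
  rw [hA.graph X hX] at hY
  obtain ⟨m, hm, rfl⟩ := hY
  have hm1 : ‖m‖ = 1 := by simpa using (hA.directions X hX hm).1
  have hs := hA.pos X hX m hm
  simp only [add_sub_cancel_left]
  rw [dir_smul_unit hs hm1, norm_smul, hm1, mul_one, Real.norm_of_nonneg hs.le]
  exact ⟨hm, rfl, hs⟩

theorem HypA.mem_target (hA : HypA κ c₁ c₂ Ω T E s) {X m : Space n} (hX : X ∈ Gam c₁ c₂ Ω)
    (hm : m ∈ E X) : X + s X m • m ∈ T := by
  rw [hA.graph X hX]
  exact ⟨m, hm, rfl⟩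

/-- The target is far: `c₂ ≤ κ |Y - X|`. -/
theorem HypB.le_dist (hB : HypB κ c₁ c₂ Ω T) (hA : HypA κ c₁ c₂ Ω T E s) (hκ0 : 0 < κ)
    (hc₁ : 0 < c₁) (hc₂ : c₁ < c₂) (hΩ : Ω ⊆ unitSphere n) {X Y : Space n}
    (hX : X ∈ Gam c₁ c₂ Ω) (hY : Y ∈ T) : c₂ ≤ κ * ‖Y - X‖ := by
  have hXn := norm_mem_of_mem_Gam hc₁ hΩ hX
  have hX0 : X ≠ 0 := by
    rw [← norm_pos_iff]; linarith [hXn.1]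
  -- H.B is used at the outer end of the ray through `X`, so that the bound involves `c₂` and not
  -- `|X|`.
  have hX' := smul_dir_mem_Gam hc₁ hΩ hX (r := c₂) ⟨hc₂.le, le_rfl⟩
  have hb := hB _ hX' Y hY
  have hpos := (hA.polar hX' hY).2.2
  rw [div_le_iff₀ hpos, norm_smul, norm_dir hX0, mul_one,
    Real.norm_of_nonneg (hc₁.trans hc₂).le] at hb
  have htri : ‖Y - c₂ • dir X‖ ≤ ‖Y - X‖ + (c₂ - ‖X‖) := by
    have e : Y - c₂ • dir X = (Y - X) - (c₂ - ‖X‖) • dir X := by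
      rw [sub_smul, norm_smul_dir]; abel
    rw [e]
    refine (norm_sub_le _ _).trans ?_
    rw [norm_smul, norm_dir hX0, mul_one, Real.norm_of_nonneg (by linarith [hXn.2])]
  -- From `√(1 + y²) ≤ 1 + y`; this weaker form of H.B is enough.
  have hδ : √(1 + ((1 + κ) ^ 2)⁻¹) - 1 ≤ (1 + κ)⁻¹ := by
    rw [sub_le_iff_le_add, Real.sqrt_le_left (by positivity), ← inv_pow]
    have : 0 < (1 + κ)⁻¹ := by positivity
    nlinarith
  have h1 : c₂ ≤ κ * (1 + κ)⁻¹ * (‖Y - X‖ + c₂) := by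
    refine hb.trans ?_
    have : ‖Y - c₂ • dir X‖ ≤ ‖Y - X‖ + c₂ := htri.trans (by linarith [norm_nonneg X])
    gcongr
  have h2 : c₂ * (1 + κ) ≤ κ * (‖Y - X‖ + c₂) := by
    have := mul_le_mul_of_nonneg_right h1 (show 0 ≤ 1 + κ by positivity)
    calc _ ≤ _ := this
      _ = _ := by field_simp
  linarith

/-- Distances from `Γ` to the target are uniformly bounded. -/
theorem HypA.exists_dist_le (hA : HypA κ c₁ c₂ Ω T E s) (hc₁ : 0 < c₁) (hΩ : Ω ⊆ unitSphere n) :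
    ∃ S > 0, ∀ X ∈ Gam c₁ c₂ Ω, ∀ Y ∈ T, ‖Y - X‖ ≤ S := by
  -- One reference pair suffices: directions differ by at most `2`, so the Lipschitz bound on `s_X₁`
  -- controls all distances from `X₁`.
  by_cases hne : ∃ X₁ ∈ Gam c₁ c₂ Ω, ∃ Y₁ : Space n, Y₁ ∈ T
  · obtain ⟨X₁, hX₁, Y₁, hY₁⟩ := hne
    obtain ⟨C, hC, hlip⟩ := hA.lipschitz
    have hn1 := norm_mem_of_mem_Gam hc₁ hΩ hX₁
    refine ⟨‖Y₁ - X₁‖ + C * 2 + 2 * c₂, by nlinarith [norm_nonneg (Y₁ - X₁), hn1.1, hn1.2], ?_⟩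
    intro X hX Y hY
    obtain ⟨h1, h2, -⟩ := hA.polar hX₁ hY
    obtain ⟨h3, h4, -⟩ := hA.polar hX₁ hY₁
    have hl := hlip X₁ hX₁ _ h1 _ h3
    rw [h2, h4] at hl
    have hm1 : ‖dir (Y - X₁)‖ = 1 := by simpa using (hA.directions X₁ hX₁ h1).1
    have hm2 : ‖dir (Y₁ - X₁)‖ = 1 := by simpa using (hA.directions X₁ hX₁ h3).1
    have h5 : ‖dir (Y - X₁) - dir (Y₁ - X₁)‖ ≤ 2 := (norm_sub_le _ _).trans (by linarith)
    have h6 : ‖Y - X₁‖ ≤ ‖Y₁ - X₁‖ + C * 2 := by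
      nlinarith [le_abs_self (‖Y - X₁‖ - ‖Y₁ - X₁‖)]
    have h7 : ‖Y - X‖ ≤ ‖Y - X₁‖ + (‖X₁‖ + ‖X‖) := by
      have : Y - X = (Y - X₁) + (X₁ - X) := by abel
      rw [this]
      exact (norm_add_le _ _).trans (by linarith [norm_sub_le X₁ X])
    have hn := norm_mem_of_mem_Gam hc₁ hΩ hX
    linarith [hn.2, hn1.2]
  · push Not at hne
    exact ⟨1, one_pos, fun X hX Y hY => absurd hY (hne X hX Y)⟩

end Target

/-! ### The quantitative maximum principle -/

/-- Comparison of optical lengths at two points, cleared of square roots. -/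
theorem opticalLength_sub_mul {n : ℕ} {κ : ℝ} {X₀ X m : Space n} {t : ℝ}
    (hm : ‖m‖ = 1) (ht : 0 < t) :
    (opticalLength κ (X₀ + t • m) X - opticalLength κ (X₀ + t • m) X₀) *
        (κ * ‖X - (X₀ + t • m)‖ + κ * t - (‖X‖ - ‖X₀‖)) =
      2 * t * (1 / t * ((κ ^ 2 * ‖X - X₀‖ ^ 2 - (‖X‖ - ‖X₀‖) ^ 2) / 2) - κ ^ 2 * ⟪m, X - X₀⟫ +
        κ * (‖X‖ - ‖X₀‖)) := by
  have h1 : ‖X₀ - (X₀ + t • m)‖ = t := by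
    rw [sub_add_cancel_left, norm_neg, norm_smul, hm, mul_one, Real.norm_of_nonneg ht.le]
  have h2 : ‖X - (X₀ + t • m)‖ ^ 2 = ‖X - X₀‖ ^ 2 - 2 * t * ⟪m, X - X₀⟫ + t ^ 2 := by
    rw [← sub_sub, norm_sub_sq_real, inner_smul_right, norm_smul, hm, mul_one,
      Real.norm_of_nonneg ht.le, real_inner_comm]
    ring
  unfold opticalLength
  rw [h1]
  field_simp
  linear_combination κ ^ 2 * h2

/-- The exact convexity gap of the norm at `X₀`. Its factor `1/|X₀|` matches the correction `μ/|X₀|`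
in H.C, which makes the two comparable. -/
theorem norm_sub_sub_inner_dir {n : ℕ} {X₀ : Space n} (hX₀ : X₀ ≠ 0) (X : Space n) :
    (‖X‖ - ‖X₀‖) - ⟪dir X₀, X - X₀⟫ =
      (‖X - X₀‖ ^ 2 - (‖X‖ - ‖X₀‖) ^ 2) / (2 * ‖X₀‖) := by
  have h0 : ‖X₀‖ ≠ 0 := norm_ne_zero_iff.2 hX₀
  have h1 : ⟪dir X₀, X - X₀⟫ = ‖X₀‖⁻¹ * (⟪X₀, X⟫ - ‖X₀‖ ^ 2) := by
    rw [dir, inner_smul_left, inner_sub_right, real_inner_self_eq_norm_sq]; simp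
  rw [h1, norm_sub_sq_real, real_inner_comm]
  field_simp
  ring

/-- Either the ray length grows so fast that the optical length increases, or the concavity of `1 / s`
yields a quadratic gain. -/
theorem growth_or_gain {κ μ ρ c₂ w d β l pb ph pl τ cβ Cp c : ℝ} (hκ0 : 0 < κ) (hκ1 : κ < 1)
    (hμκ : μ < κ) (hρ0 : 0 < ρ) (hρ : ρ ≤ c₂) (hw : 0 ≤ w) (hdw : |d| ≤ w)
    (hd : -(κ * w) ≤ d) (hτ0 : 0 ≤ τ) (hτ2 : τ ≤ 2) (hcβ : 0 < cβ) (hβ : cβ * τ ^ 2 ≤ 1 - β)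
    (hc0 : 0 < c) (hc : c ≤ (1 - κ ^ 2) / 8) (hcp : c * Cp ≤ cβ * κ * (1 - κ ^ 2) / (8 * c₂))
    (hC : (1 - l) * β * (pb + μ / ρ) + l * β * (ph + μ / ρ) ≤ pl + μ / ρ)
    (hp : pl - β * ((1 - l) * pb + l * ph) ≤ Cp * τ) (hCp : 0 ≤ Cp) :
    c * τ * w ≤ d - κ * w ∨
      cβ * κ * (1 - κ ^ 2) / (8 * c₂) * τ ^ 2 * w ^ 2 ≤
        (κ ^ 2 * w ^ 2 - d ^ 2) / 2 * (pl - β * ((1 - l) * pb + l * ph)) +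
          (1 - β) * (κ * (w ^ 2 - d ^ 2) / (2 * ρ)) := by
  have hc₂ : 0 < c₂ := hρ0.trans_le hρ
  have hk : 0 < 1 - κ ^ 2 := by nlinarith
  have h1β : 0 ≤ 1 - β := le_trans (by positivity) hβ
  obtain ⟨q, hq⟩ : ∃ q, q = (1 - l) * pb + l * ph := ⟨_, rfl⟩
  obtain ⟨g, hg⟩ : ∃ g, g = cβ * κ * (1 - κ ^ 2) / (8 * c₂) := ⟨_, rfl⟩
  rw [← hq] at hp ⊢
  rw [← hg] at hcp ⊢
  have hg0 : 0 < g := by rw [hg]; positivity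
  have hgρ : g * (8 * ρ) ≤ cβ * κ * (1 - κ ^ 2) := by
    calc g * (8 * ρ) ≤ g * (8 * c₂) := by gcongr
      _ = _ := by rw [hg]; field_simp
  -- The sign of `A` decides whether the lower bound from H.C helps. For `A ≥ 0` its loss
  -- `(1-β)μA/ρ` is dominated by the convexity term because `μ < κ`.
  by_cases hA : d ^ 2 ≤ κ ^ 2 * w ^ 2
  · right
    have hpl : -((1 - β) * (μ / ρ)) ≤ pl - β * q := by rw [hq]; linarith
    have h1 : (κ ^ 2 * w ^ 2 - d ^ 2) / 2 * (-((1 - β) * (μ / ρ))) ≤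
        (κ ^ 2 * w ^ 2 - d ^ 2) / 2 * (pl - β * q) :=
      mul_le_mul_of_nonneg_left hpl (by linarith)
    have h2 : κ * (1 - κ ^ 2) * w ^ 2 ≤ κ * (w ^ 2 - d ^ 2) - μ * (κ ^ 2 * w ^ 2 - d ^ 2) := by
      nlinarith [mul_nonneg (sub_nonneg.2 hμκ.le) (sub_nonneg.2 hA)]
    have h3 : (1 - β) * (κ * (1 - κ ^ 2) * w ^ 2 / (2 * ρ)) ≤
        (1 - β) * ((κ * (w ^ 2 - d ^ 2) - μ * (κ ^ 2 * w ^ 2 - d ^ 2)) / (2 * ρ)) := by gcongr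
    have h4 : (1 - β) * ((κ * (w ^ 2 - d ^ 2) - μ * (κ ^ 2 * w ^ 2 - d ^ 2)) / (2 * ρ)) =
        (κ ^ 2 * w ^ 2 - d ^ 2) / 2 * (-((1 - β) * (μ / ρ))) +
          (1 - β) * (κ * (w ^ 2 - d ^ 2) / (2 * ρ)) := by
      field_simp; ring
    have h5 : g * τ ^ 2 * w ^ 2 ≤ (1 - β) * (κ * (1 - κ ^ 2) * w ^ 2 / (2 * ρ)) := by
      calc g * τ ^ 2 * w ^ 2 ≤ (cβ * τ ^ 2) * (κ * (1 - κ ^ 2) * w ^ 2 / (2 * ρ)) := by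
            rw [← mul_div_assoc, le_div_iff₀ (by positivity)]
            have := mul_le_mul_of_nonneg_right hgρ (show 0 ≤ τ ^ 2 * w ^ 2 by positivity)
            have h6 : 0 ≤ g * ρ * (τ ^ 2 * w ^ 2) := by positivity
            linarith
        _ ≤ _ := by gcongr
    linarith
  · push Not at hA
    have hd0 : 0 ≤ d := by
      by_contra hneg
      push Not at hneg
      have hκw : 0 ≤ κ * w := by positivity
      have := sq_le_sq' hd (hneg.le.trans hκw)
      rw [mul_pow] at this
      linarith
    have hdw' : d ≤ w := (le_abs_self d).trans hdw
    -- Now `A < 0`, and an upper bound on the concavity defect is needed. If `d` barely exceeds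
    -- `κw`, then `|A| ≤ cτw²` and the defect is at most `Cp τ`; the smallness of `c` lets half of
    -- the convexity term absorb the loss. Otherwise `d - κw` itself is large.
    by_cases hB : d ^ 2 ≤ κ ^ 2 * w ^ 2 + 2 * c * τ * w ^ 2
    · right
      have hτc : 2 * c * τ * w ^ 2 ≤ (1 - κ ^ 2) / 2 * w ^ 2 := by
        have : c * τ ≤ (1 - κ ^ 2) / 8 * 2 := mul_le_mul hc hτ2 hτ0 (by positivity)
        nlinarith [sq_nonneg w]
      have hD : (1 - κ ^ 2) / 2 * w ^ 2 ≤ w ^ 2 - d ^ 2 := by linarith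
      have h1 : -(c * τ * w ^ 2 * (Cp * τ)) ≤ (κ ^ 2 * w ^ 2 - d ^ 2) / 2 * (pl - β * q) := by
        have e1 : (d ^ 2 - κ ^ 2 * w ^ 2) / 2 * (pl - β * q) ≤
            (d ^ 2 - κ ^ 2 * w ^ 2) / 2 * (Cp * τ) :=
          mul_le_mul_of_nonneg_left hp (by linarith)
        have e2 : (d ^ 2 - κ ^ 2 * w ^ 2) / 2 * (Cp * τ) ≤ c * τ * w ^ 2 * (Cp * τ) :=
          mul_le_mul_of_nonneg_right (by linarith) (by positivity)
        linarith
      have h2 : c * τ * w ^ 2 * (Cp * τ) ≤ g * τ ^ 2 * w ^ 2 := by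
        calc c * τ * w ^ 2 * (Cp * τ) = c * Cp * (τ ^ 2 * w ^ 2) := by ring
          _ ≤ g * (τ ^ 2 * w ^ 2) := by gcongr
          _ = _ := by ring
      have h3 : 2 * (g * τ ^ 2 * w ^ 2) ≤ (1 - β) * (κ * (w ^ 2 - d ^ 2) / (2 * ρ)) := by
        calc 2 * (g * τ ^ 2 * w ^ 2)
            ≤ (cβ * τ ^ 2) * (κ * ((1 - κ ^ 2) / 2 * w ^ 2) / (2 * ρ)) := by
              rw [← mul_div_assoc, le_div_iff₀ (by positivity)]
              have := mul_le_mul_of_nonneg_right hgρ (show 0 ≤ τ ^ 2 * w ^ 2 by positivity)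
              linarith
          _ ≤ (1 - β) * (κ * (w ^ 2 - d ^ 2) / (2 * ρ)) := by gcongr
      linarith
    · left
      push Not at hB
      have hw0 : 0 < w := by
        rcases hw.eq_or_lt with h | h
        · rw [← h] at hB hdw'
          have : d ^ 2 ≤ 0 ^ 2 := pow_le_pow_left₀ hd0 hdw' 2
          linarith
        · exact h
      have hκw : κ * w ≤ w := mul_le_of_le_one_left hw hκ1.le
      have h1 : κ * w < d := by
        refine lt_of_pow_lt_pow_left₀ 2 hd0 ?_
        rwa [mul_pow]
      by_contra hcon
      push Not at hcon
      have h2 : (d - κ * w) * (d + κ * w) ≤ (c * τ * w) * (2 * w) := by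
        refine mul_le_mul hcon.le (by linarith) ?_ (by positivity)
        have : 0 ≤ κ * w := by positivity
        linarith
      linarith

variable {n : ℕ} {κ c₁ c₂ : ℝ} {Ω T : Set (Space n)} {E : Space n → Set (Space n)}
  {s : Space n → Space n → ℝ} {u : Space n → ℝ}

/-- The difference of optical lengths at two points is at least the growth of the ray length minus
`κ` times the distance. -/
theorem sub_le_opticalLength_sub {n : ℕ} {κ : ℝ} (hκ0 : 0 < κ) (X X₀ Y : Space n) :
    (‖X‖ - ‖X₀‖) - κ * ‖X - X₀‖ ≤ opticalLength κ Y X - opticalLength κ Y X₀ := by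
  unfold opticalLength
  have h1 : ‖X₀ - Y‖ ≤ ‖X - X₀‖ + ‖X - Y‖ := by
    have e : X₀ - Y = -(X - X₀) + (X - Y) := by abel
    rw [e]
    exact (norm_add_le _ _).trans (by rw [norm_neg])
  nlinarith

theorem opticalLength_sub_le {n : ℕ} {κ : ℝ} (hκ0 : 0 < κ) (X X₀ Y : Space n) :
    opticalLength κ Y X - opticalLength κ Y X₀ ≤ (‖X‖ - ‖X₀‖) + κ * ‖X - X₀‖ := by
  have := sub_le_opticalLength_sub hκ0 X₀ X Y
  rw [norm_sub_rev] at this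
  linarith

/-- Points of the target are as close as their directions. -/
theorem HypA.exists_norm_sub_le (hA : HypA κ c₁ c₂ Ω T E s) (hc₁ : 0 < c₁)
    (hΩ : Ω ⊆ unitSphere n) :
    ∃ M > 0, ∀ X ∈ Gam c₁ c₂ Ω, ∀ Y ∈ T, ∀ Y' ∈ T,
      ‖Y - Y'‖ ≤ M * ‖dir (Y - X) - dir (Y' - X)‖ := by
  obtain ⟨S, hS, hSd⟩ := hA.exists_dist_le hc₁ hΩ
  obtain ⟨C, hC, hlip⟩ := hA.lipschitz
  refine ⟨C + S, by positivity, fun X hX Y hY Y' hY' => ?_⟩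
  obtain ⟨h1, h2, -⟩ := hA.polar hX hY
  obtain ⟨h3, h4, -⟩ := hA.polar hX hY'
  have hl := hlip X hX _ h1 _ h3
  rw [h2, h4] at hl
  have hm1 : ‖dir (Y - X)‖ = 1 := by simpa using (hA.directions X hX h1).1
  have e : Y - Y' = (‖Y - X‖ - ‖Y' - X‖) • dir (Y - X) +
      ‖Y' - X‖ • (dir (Y - X) - dir (Y' - X)) := by
    rw [sub_smul, smul_sub, norm_smul_dir, norm_smul_dir]; abel
  rw [e]
  refine (norm_add_le _ _).trans ?_
  rw [norm_smul, norm_smul, hm1, mul_one, norm_norm, Real.norm_eq_abs, add_mul]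
  have := hSd X hX Y' hY'
  gcongr

theorem one_div_le_one_div_add {a b s₀ e : ℝ} (hs₀ : 0 < s₀) (ha : s₀ ≤ a) (hb : s₀ ≤ b)
    (h : |a - b| ≤ e) : 1 / a ≤ 1 / b + e / s₀ ^ 2 := by
  have ha0 := hs₀.trans_le ha
  have hb0 := hs₀.trans_le hb
  have h1 : 1 / a - 1 / b = (b - a) / (a * b) := by field_simp
  have h2 : (b - a) / (a * b) ≤ e / s₀ ^ 2 := by
    have h3 : b - a ≤ e := by linarith [neg_abs_le (a - b)]
    have he : 0 ≤ e := (abs_nonneg _).trans h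
    calc (b - a) / (a * b) ≤ e / (a * b) := by gcongr
      _ ≤ e / s₀ ^ 2 := by
        rw [sq]; gcongr
  linarith

set_option maxHeartbeats 400000 in
/-- The scalar core of the maximum principle. Here `tb, th, tl` are the distances from `X₀` to the
three targets, `Gb, Gh, Gl` the increments of the optical lengths, `d` the increment of the ray length
and `w = |X - X₀|`. -/
theorem optical_gain {κ μ ρ c₁ c₂ w d β l τ cβ Cp c' g S s₀ L I ib ih il tb th tl ab ah al Gb Gh
    Gl e : ℝ}
    (hκ0 : 0 < κ) (hκ1 : κ < 1) (hμκ : μ < κ) (hρ0 : 0 < ρ) (hρ : ρ ≤ c₂) (hc₁ : 0 < c₁)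
    (hw : 0 ≤ w) (hw2 : w ≤ 2 * c₂) (hdw : |d| ≤ w) (hτ0 : 0 ≤ τ) (hτ2 : τ ≤ 2) (hcβ : 0 < cβ)
    (hβ : cβ * τ ^ 2 ≤ 1 - β) (hβ0 : 0 ≤ β) (hl : l ∈ Set.Icc (0 : ℝ) 1)
    (hc0 : 0 < c') (hc : c' ≤ (1 - κ ^ 2) / 8) (hg : g = cβ * κ * (1 - κ ^ 2) / (8 * c₂))
    (hcp : c' * Cp ≤ g) (hCp : 0 ≤ Cp) (hs₀ : 0 < s₀) (hκs₀ : κ * s₀ = c₂)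
    (hL : L = (κ * S + c₂) / s₀)
    (hC : (1 - l) * β * (1 / tb + μ / ρ) + l * β * (1 / th + μ / ρ) ≤ 1 / tl + μ / ρ)
    (hp : 1 / tl - β * ((1 - l) * (1 / tb) + l * (1 / th)) ≤ Cp * τ)
    (hd2 : d ≤ c₂ - c₁) (hd3 : -c₂ ≤ d) (htb : s₀ ≤ tb) (hth : s₀ ≤ th) (htl : s₀ ≤ tl)
    (hthS : th ≤ S) (htlS : tl ≤ S) (hab0 : 0 ≤ ab) (hah0 : 0 ≤ ah) (hal0 : 0 ≤ al)
    (hah : ah ≤ S) (hal : al ≤ S)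
    (hD : d - I = (w ^ 2 - d ^ 2) / (2 * ρ))
    (hll : -κ ^ 2 * il + κ * I =
      β * ((1 - l) * (-κ ^ 2 * ib + κ * I) + l * (-κ ^ 2 * ih + κ * I)))
    (hGb : Gb * (κ * ab + κ * tb - d) =
      2 * tb * (1 / tb * ((κ ^ 2 * w ^ 2 - d ^ 2) / 2) - κ ^ 2 * ib + κ * d))
    (hGh : Gh * (κ * ah + κ * th - d) =
      2 * th * (1 / th * ((κ ^ 2 * w ^ 2 - d ^ 2) / 2) - κ ^ 2 * ih + κ * d))
    (hGl : Gl * (κ * al + κ * tl - d) =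
      2 * tl * (1 / tl * ((κ ^ 2 * w ^ 2 - d ^ 2) / 2) - κ ^ 2 * il + κ * d))
    (hGb0 : 0 ≤ Gb) (hGbup : Gb ≤ d + κ * w) (hGh0 : -e ≤ Gh) (he : 0 ≤ e)
    (hGllow : d - κ * w ≤ Gl) (heg : e ≤ g / (2 * L) * τ ^ 2 * w ^ 2) :
    c' / (4 * c₂) * τ ^ 2 * w ^ 2 ≤ Gl ∨ g / (2 * L) * τ ^ 2 * w ^ 2 ≤ Gl := by
  have hc₂ : 0 < c₂ := hρ0.trans_le hρ
  have hk : 0 < 1 - κ ^ 2 := sub_pos.2 (pow_lt_one₀ hκ0.le hκ1 two_ne_zero)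
  have hg0 : 0 < g := by rw [hg]; positivity
  have hS : 0 < S := by linarith
  have hL0 : 0 < L := by rw [hL]; positivity
  have hLs : L * s₀ = κ * S + c₂ := by rw [hL]; field_simp
  rcases growth_or_gain (c := c') hκ0 hκ1 hμκ hρ0 hρ hw hdw (by linarith) hτ0 hτ2 hcβ hβ hc0 hc
    (hg ▸ hcp) hC hp hCp with h | h
  · left
    refine le_trans ?_ (h.trans hGllow)
    have h1 : τ * w ≤ 4 * c₂ := by
      calc τ * w ≤ 2 * (2 * c₂) := mul_le_mul hτ2 hw2 hw (by norm_num)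
        _ = _ := by ring
    have h2 : 0 ≤ c' * τ * w := by positivity
    calc c' / (4 * c₂) * τ ^ 2 * w ^ 2 = c' * τ * w * (τ * w) / (4 * c₂) := by ring
      _ ≤ c' * τ * w * (4 * c₂) / (4 * c₂) := by gcongr
      _ = c' * τ * w := by field_simp
  · right
    rw [← hg] at h
    -- Distance from the target enters here: `κt ≥ κs₀ = c₂ > d`, so clearing the square roots
    -- preserves signs.
    have hpos : ∀ a t : ℝ, 0 ≤ a → s₀ ≤ t → 0 < κ * a + κ * t - d := by
      intro a t ha ht
      have h1 : 0 ≤ κ * a := by positivity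
      have h2 : κ * s₀ ≤ κ * t := by gcongr
      linarith
    have hle : ∀ a t : ℝ, a ≤ S → t ≤ S → s₀ ≤ t → κ * a + κ * t - d ≤ L * (2 * t) := by
      intro a t ha hts ht
      have h1 : κ * a ≤ κ * S := by gcongr
      have h2 : κ * t ≤ κ * S := by gcongr
      have h3 : L * (2 * s₀) ≤ L * (2 * t) := by gcongr
      linarith
    obtain ⟨A, hAdef⟩ : ∃ A, A = (κ ^ 2 * w ^ 2 - d ^ 2) / 2 := ⟨_, rfl⟩
    rw [← hAdef] at h hGb hGh hGl
    obtain ⟨Pb, hPb⟩ : ∃ P, P = 1 / tb * A - κ ^ 2 * ib + κ * d := ⟨_, rfl⟩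
    obtain ⟨Ph, hPh⟩ : ∃ P, P = 1 / th * A - κ ^ 2 * ih + κ * d := ⟨_, rfl⟩
    obtain ⟨Pl, hPl⟩ : ∃ P, P = 1 / tl * A - κ ^ 2 * il + κ * d := ⟨_, rfl⟩
    rw [← hPb] at hGb
    rw [← hPh] at hGh
    rw [← hPl] at hGl
    have htb0 := hs₀.trans_le htb
    have hth0 := hs₀.trans_le hth
    have htl0 := hs₀.trans_le htl
    have hPb0 : 0 ≤ Pb := by
      have : 0 ≤ 2 * tb * Pb := hGb ▸ mul_nonneg hGb0 (hpos ab tb hab0 htb).le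
      exact nonneg_of_mul_nonneg_right this (by positivity)
    have hPh0 : -(L * e) ≤ Ph := by
      have h1 : -e * (κ * ah + κ * th - d) ≤ 2 * th * Ph :=
        hGh ▸ mul_le_mul_of_nonneg_right hGh0 (hpos ah th hah0 hth).le
      have h2 : e * (κ * ah + κ * th - d) ≤ e * (L * (2 * th)) :=
        mul_le_mul_of_nonneg_left (hle ah th hah hthS hth) he
      have h3 : 2 * th * (-(L * e)) ≤ 2 * th * Ph := by linarith
      exact le_of_mul_le_mul_left h3 (by positivity)
    have hDκ : κ * (d - I) = κ * (w ^ 2 - d ^ 2) / (2 * ρ) := by rw [hD]; ring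
    rw [← hDκ] at h
    -- The part linear in `m - x₀/κ` cancels by `hll`; what remains is exactly the quantity bounded
    -- below by `growth_or_gain`.
    have hid : Pl = β * ((1 - l) * Pb + l * Ph) +
        (A * (1 / tl - β * ((1 - l) * (1 / tb) + l * (1 / th))) + (1 - β) * (κ * (d - I))) := by
      rw [hPl, hPb, hPh]
      linear_combination hll
    have hLe : 0 ≤ L * e := by positivity
    have hβ1 : β ≤ 1 := by
      have : 0 ≤ cβ * τ ^ 2 := by positivity
      linarith
    have hsum : -(L * e) ≤ β * ((1 - l) * Pb + l * Ph) := by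
      have h1 : 0 ≤ (1 - l) * Pb := mul_nonneg (by linarith [hl.2]) hPb0
      have h2 : l * (-(L * e)) ≤ l * Ph := mul_le_mul_of_nonneg_left hPh0 hl.1
      have h3 : l * (L * e) ≤ L * e := mul_le_of_le_one_left hLe hl.2
      have h4 : β * (-(L * e)) ≤ β * ((1 - l) * Pb + l * Ph) :=
        mul_le_mul_of_nonneg_left (by linarith) hβ0
      have h5 : β * (L * e) ≤ L * e := mul_le_of_le_one_left hLe hβ1
      linarith
    have heL : L * e ≤ g * τ ^ 2 * w ^ 2 / 2 := by
      calc L * e ≤ L * (g / (2 * L) * τ ^ 2 * w ^ 2) := by gcongr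
        _ = _ := by field_simp
    have hPlow : g * τ ^ 2 * w ^ 2 / 2 ≤ Pl := by rw [hid]; linarith
    have hden := hpos al tl hal0 htl
    have hnn : 0 ≤ g / (2 * L) * τ ^ 2 * w ^ 2 := by positivity
    have h1 : g / (2 * L) * τ ^ 2 * w ^ 2 * (κ * al + κ * tl - d) ≤
        Gl * (κ * al + κ * tl - d) := by
      rw [hGl]
      calc g / (2 * L) * τ ^ 2 * w ^ 2 * (κ * al + κ * tl - d)
          ≤ g / (2 * L) * τ ^ 2 * w ^ 2 * (L * (2 * tl)) :=
            mul_le_mul_of_nonneg_left (hle al tl hal htlS htl) hnn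
        _ = 2 * tl * (g * τ ^ 2 * w ^ 2 / 2) := by field_simp
        _ ≤ _ := by gcongr
    exact le_of_mul_le_mul_right h1 hden

set_option maxHeartbeats 800000 in
/-- Quantitative maximum principle: if the optical lengths to `Ȳ` and (up to a small error) to `Ŷ` do
not decrease from `X₀` to `X`, then the optical length to the middle points of `[Ȳ, Ŷ]_{X₀}` increases
by a quadratic amount. -/
theorem exists_maximum_principle (hκ0 : 0 < κ) (hκ1 : κ < 1) (hc₁ : 0 < c₁) (hc₂ : c₁ < c₂)
    (hΩ : Ω ⊆ unitSphere n) (hA : HypA κ c₁ c₂ Ω T E s) (hB : HypB κ c₁ c₂ Ω T)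
    (hC : HypC κ c₁ c₂ Ω E s) :
    ∃ c > 0, ∀ X₀ ∈ Gam c₁ c₂ Ω, ∀ X ∈ Gam c₁ c₂ Ω, ∀ Yb ∈ T, ∀ Yh ∈ T,
      ∀ l ∈ Set.Icc (1 / 4 : ℝ) (3 / 4), ∀ e : ℝ, 0 ≤ e →
      opticalLength κ Yb X₀ ≤ opticalLength κ Yb X →
      opticalLength κ Yh X₀ - e ≤ opticalLength κ Yh X →
      e ≤ c * ‖Yb - Yh‖ ^ 2 * ‖X - X₀‖ ^ 2 →
      c * ‖Yb - Yh‖ ^ 2 * ‖X - X₀‖ ^ 2 ≤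
        opticalLength κ (targetCurvePt κ s X₀ Yb Yh l) X -
          opticalLength κ (targetCurvePt κ s X₀ Yb Yh l) X₀ := by
  obtain ⟨S, hS, hSd⟩ := hA.exists_dist_le hc₁ hΩ
  obtain ⟨M, hM, hMd⟩ := hA.exists_norm_sub_le hc₁ hΩ
  obtain ⟨C, hC0, hlip⟩ := hA.lipschitz
  obtain ⟨μ, hμ0, hμκ, hconc⟩ := hC
  have hc₂0 : 0 < c₂ := hc₁.trans hc₂
  have hk : 0 < 1 - κ ^ 2 := sub_pos.2 (pow_lt_one₀ hκ0.le hκ1 two_ne_zero)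
  obtain ⟨s₀, hs₀⟩ : ∃ s₀, s₀ = c₂ / κ := ⟨_, rfl⟩
  have hs₀0 : 0 < s₀ := by rw [hs₀]; positivity
  have hs₀d : ∀ X ∈ Gam c₁ c₂ Ω, ∀ Y ∈ T, s₀ ≤ ‖Y - X‖ := fun X hX Y hY => by
    rw [hs₀, div_le_iff₀' hκ0]; exact hB.le_dist hA hκ0 hc₁ hc₂ hΩ hX hY
  -- `3/16` is the minimum of `l(1-l)` on `[1/4, 3/4]`.
  obtain ⟨cβ, hcβ⟩ : ∃ cβ, cβ = κ / (2 * (1 + κ)) * (3 / 16) := ⟨_, rfl⟩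
  have hcβ0 : 0 < cβ := by rw [hcβ]; positivity
  -- The first summand bounds the variation of `1/s` from the end points to `m(λ)`, which is within
  -- `2|m̄ - m̂|` of both; the second bounds the effect of replacing `β` by `1`.
  obtain ⟨Cp, hCp⟩ : ∃ Cp, Cp = C * 2 / s₀ ^ 2 + κ / (1 - κ) * (1 / s₀) := ⟨_, rfl⟩
  have h1κ : 0 < 1 - κ := by linarith
  have hCp0 : 0 < Cp := by rw [hCp]; positivity
  obtain ⟨g, hg⟩ : ∃ g, g = cβ * κ * (1 - κ ^ 2) / (8 * c₂) := ⟨_, rfl⟩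
  have hg0 : 0 < g := by rw [hg]; positivity
  obtain ⟨c', hc', hc'1, hc'2⟩ : ∃ c' > 0, c' ≤ (1 - κ ^ 2) / 8 ∧ c' * Cp ≤ g :=
    ⟨min ((1 - κ ^ 2) / 8) (g / Cp), lt_min (by positivity) (by positivity), min_le_left _ _,
      by rw [← le_div_iff₀ hCp0]; exact min_le_right _ _⟩
  obtain ⟨L, hL⟩ : ∃ L, L = (κ * S + c₂) / s₀ := ⟨_, rfl⟩
  have hL0 : 0 < L := by rw [hL]; positivity
  -- Division by `M²` converts a gain in terms of directions into one in terms of target points.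
  obtain ⟨c, hc0, hcg, hcc'⟩ : ∃ c > 0, c * M ^ 2 ≤ g / (2 * L) ∧ c * M ^ 2 ≤ c' / (4 * c₂) :=
    ⟨min (g / (2 * L)) (c' / (4 * c₂)) / M ^ 2, by positivity,
      by rw [div_mul_cancel₀ _ (by positivity)]; exact min_le_left _ _,
      by rw [div_mul_cancel₀ _ (by positivity)]; exact min_le_right _ _⟩
  refine ⟨c, hc0, ?_⟩
  intro X₀ hX₀ X hX Yb hYb Yh hYh l hl e he hGb hGh hec
  have hl01 : l ∈ Set.Icc (0 : ℝ) 1 := ⟨by linarith [hl.1], by linarith [hl.2]⟩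
  obtain ⟨hmb, hsb, -⟩ := hA.polar hX₀ hYb
  obtain ⟨hmh, hsh, -⟩ := hA.polar hX₀ hYh
  have hδ := hMd X₀ hX₀ Yb hYb Yh hYh
  have hYbe : X₀ + ‖Yb - X₀‖ • dir (Yb - X₀) = Yb := by rw [norm_smul_dir]; abel
  have hYhe : X₀ + ‖Yh - X₀‖ • dir (Yh - X₀) = Yh := by rw [norm_smul_dir]; abel
  have hsb0 := hs₀d X₀ hX₀ Yb hYb
  have hsh0 := hs₀d X₀ hX₀ Yh hYh
  have hYl : targetCurvePt κ s X₀ Yb Yh l =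
      X₀ + s X₀ (curvePt κ (dir X₀) (dir (Yb - X₀)) (dir (Yh - X₀)) l) •
        curvePt κ (dir X₀) (dir (Yb - X₀)) (dir (Yh - X₀)) l := rfl
  have hconcl := hconc X₀ hX₀ _ hmb _ hmh l hl01
  have hml : curvePt κ (dir X₀) (dir (Yb - X₀)) (dir (Yh - X₀)) l ∈ E X₀ :=
    hA.convex X₀ hX₀ _ hmb _ hmh ⟨l, hl01, rfl⟩
  obtain ⟨hmb1, hmbx⟩ := hA.directions X₀ hX₀ hmb
  obtain ⟨hmh1, hmhx⟩ := hA.directions X₀ hX₀ hmh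
  obtain ⟨hml1, -⟩ := hA.directions X₀ hX₀ hml
  have hn₀ := norm_mem_of_mem_Gam hc₁ hΩ hX₀
  have hn := norm_mem_of_mem_Gam hc₁ hΩ hX
  have hX₀0 : X₀ ≠ 0 := by rw [← norm_pos_iff]; linarith [hn₀.1]
  have hx₀1 := norm_dir hX₀0
  rw [mem_sphere_zero_iff_norm] at hmb1 hmh1 hml1
  obtain ⟨hβ0, hβ1, hβlow, -, hβup⟩ := beta_bounds hκ0 hκ1 hx₀1 hmb1 hmh1 hmbx hmhx hl01
  obtain ⟨hmlb, hmlh⟩ := norm_curvePt_sub_le hκ0 hκ1 hx₀1 hmb1 hmh1 hmbx hmhx hl01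
  have hlb := hlip X₀ hX₀ _ hml _ hmb
  have hlh := hlip X₀ hX₀ _ hml _ hmh
  have hslpos := hA.pos X₀ hX₀ _ hml
  have hYlT := hA.mem_target hX₀ hml
  have hsl0 : s₀ ≤ s X₀ (curvePt κ (dir X₀) (dir (Yb - X₀)) (dir (Yh - X₀)) l) := by
    have := hs₀d X₀ hX₀ _ hYlT
    rwa [add_sub_cancel_left, norm_smul, hml1, mul_one, Real.norm_of_nonneg hslpos.le] at this
  have hcurve : curvePt κ (dir X₀) (dir (Yb - X₀)) (dir (Yh - X₀)) l - κ⁻¹ • dir X₀ =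
      beta κ (dir X₀) (dir (Yb - X₀)) (dir (Yh - X₀)) l •
        ((1 - l) • (dir (Yb - X₀) - κ⁻¹ • dir X₀) + l • (dir (Yh - X₀) - κ⁻¹ • dir X₀)) := by
    unfold curvePt chord; module
  have hτ2 : ‖dir (Yb - X₀) - dir (Yh - X₀)‖ ≤ 2 := (norm_sub_le _ _).trans (by linarith)
  have hτ0 := norm_nonneg (dir (Yb - X₀) - dir (Yh - X₀))
  rw [hsb, hsh] at hconcl
  rw [hsb] at hlb
  rw [hsh] at hlh
  have hGbid := opticalLength_sub_mul (κ := κ) (X₀ := X₀) (X := X) hmb1 (hs₀0.trans_le hsb0)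
  have hGhid := opticalLength_sub_mul (κ := κ) (X₀ := X₀) (X := X) hmh1 (hs₀0.trans_le hsh0)
  have hGlid := opticalLength_sub_mul (κ := κ) (X₀ := X₀) (X := X) hml1 hslpos
  have hlow := sub_le_opticalLength_sub hκ0 X X₀ (targetCurvePt κ s X₀ Yb Yh l)
  have hup := opticalLength_sub_le hκ0 X X₀ Yb
  have hYhX := hSd X hX Yh hYh
  have hYhX₀ := hSd X₀ hX₀ Yh hYh
  have hYlX := hSd X hX _ hYlT
  have hYlX₀ := hSd X₀ hX₀ _ hYlT
  rw [add_sub_cancel_left, norm_smul, hml1, mul_one, Real.norm_of_nonneg hslpos.le] at hYlX₀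
  rw [norm_sub_rev] at hYhX hYlX
  rw [hYbe] at hGbid
  rw [hYhe] at hGhid
  rw [← hYl] at hGlid hYlX hYlT
  have hD := norm_sub_sub_inner_dir hX₀0 X
  have hdw : |‖X‖ - ‖X₀‖| ≤ ‖X - X₀‖ := abs_norm_sub_norm_le X X₀
  have hw2 : ‖X - X₀‖ ≤ 2 * c₂ := (norm_sub_le _ _).trans (by linarith [hn.2, hn₀.2])
  have hw0 := norm_nonneg (X - X₀)
  have hd2 : ‖X‖ - ‖X₀‖ ≤ c₂ - c₁ := by linarith [hn.2, hn₀.1]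
  have hd3 : -c₂ ≤ ‖X‖ - ‖X₀‖ := by linarith [hn.1, hn₀.2]
  have hκs₀ : κ * s₀ = c₂ := by rw [hs₀]; field_simp
  have hlin : ∀ m : Space n, -κ ^ 2 * ⟪m, X - X₀⟫ + κ * ⟪dir X₀, X - X₀⟫ =
      -κ ^ 2 * ⟪m - κ⁻¹ • dir X₀, X - X₀⟫ := by
    intro m
    rw [inner_sub_left, inner_smul_left]
    simp only [conj_trivial]
    field_simp
    ring
  have hlb' := hlin (dir (Yb - X₀))
  have hlh' := hlin (dir (Yh - X₀))
  have hll' := hlin (curvePt κ (dir X₀) (dir (Yb - X₀)) (dir (Yh - X₀)) l)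
  rw [hcurve, inner_smul_left, inner_add_left, inner_smul_left, inner_smul_left] at hll'
  simp only [conj_trivial] at hll'
  have hp : 1 / s X₀ (curvePt κ (dir X₀) (dir (Yb - X₀)) (dir (Yh - X₀)) l) -
      beta κ (dir X₀) (dir (Yb - X₀)) (dir (Yh - X₀)) l *
        ((1 - l) * (1 / ‖Yb - X₀‖) + l * (1 / ‖Yh - X₀‖)) ≤
      Cp * ‖dir (Yb - X₀) - dir (Yh - X₀)‖ := by
    have e1 := one_div_le_one_div_add hs₀0 hsl0 hsb0
      (hlb.trans (mul_le_mul_of_nonneg_left hmlb hC0.le))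
    have e2 := one_div_le_one_div_add hs₀0 hsl0 hsh0
      (hlh.trans (mul_le_mul_of_nonneg_left hmlh hC0.le))
    have e3 : 1 / ‖Yb - X₀‖ ≤ 1 / s₀ := one_div_le_one_div_of_le hs₀0 hsb0
    have e4 : 1 / ‖Yh - X₀‖ ≤ 1 / s₀ := one_div_le_one_div_of_le hs₀0 hsh0
    have hl1 : 0 ≤ 1 - l := by linarith [hl01.2]
    have e5 := mul_le_mul_of_nonneg_left e1 hl1
    have e6 := mul_le_mul_of_nonneg_left e2 hl01.1
    have e7 : (1 - l) * (1 / ‖Yb - X₀‖) + l * (1 / ‖Yh - X₀‖) ≤ 1 / s₀ := by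
      linarith [mul_le_mul_of_nonneg_left e3 hl1, mul_le_mul_of_nonneg_left e4 hl01.1]
    have e8 : (1 - beta κ (dir X₀) (dir (Yb - X₀)) (dir (Yh - X₀)) l) *
        ((1 - l) * (1 / ‖Yb - X₀‖) + l * (1 / ‖Yh - X₀‖)) ≤
        (κ / (1 - κ) * ‖dir (Yb - X₀) - dir (Yh - X₀)‖) * (1 / s₀) := by
      refine mul_le_mul hβup e7 ?_ (by positivity)
      have := hl01.1
      positivity
    rw [hCp]
    have e9 : (C * 2 / s₀ ^ 2 + κ / (1 - κ) * (1 / s₀)) * ‖dir (Yb - X₀) - dir (Yh - X₀)‖ =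
        C * (2 * ‖dir (Yb - X₀) - dir (Yh - X₀)‖) / s₀ ^ 2 +
          (κ / (1 - κ) * ‖dir (Yb - X₀) - dir (Yh - X₀)‖) * (1 / s₀) := by ring
    rw [e9]
    linarith
  have hβlow' : cβ * ‖dir (Yb - X₀) - dir (Yh - X₀)‖ ^ 2 ≤
      1 - beta κ (dir X₀) (dir (Yb - X₀)) (dir (Yh - X₀)) l := by
    refine le_trans ?_ hβlow
    rw [hcβ, mul_assoc]
    have : 3 / 16 ≤ l * (1 - l) := by
      linarith [mul_nonneg (sub_nonneg.2 hl.1) (sub_nonneg.2 hl.2)]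
    gcongr
  have hscale : ∀ a : ℝ, c * M ^ 2 ≤ a → c * ‖Yb - Yh‖ ^ 2 * ‖X - X₀‖ ^ 2 ≤
      a * ‖dir (Yb - X₀) - dir (Yh - X₀)‖ ^ 2 * ‖X - X₀‖ ^ 2 := by
    intro a ha
    calc c * ‖Yb - Yh‖ ^ 2 * ‖X - X₀‖ ^ 2
        ≤ c * (M * ‖dir (Yb - X₀) - dir (Yh - X₀)‖) ^ 2 * ‖X - X₀‖ ^ 2 := by gcongr
      _ = c * M ^ 2 * ‖dir (Yb - X₀) - dir (Yh - X₀)‖ ^ 2 * ‖X - X₀‖ ^ 2 := by ring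
      _ ≤ _ := by gcongr
  rcases optical_gain hκ0 hκ1 hμκ (hc₁.trans_le hn₀.1) hn₀.2 hc₁ hw0 hw2 hdw hτ0 hτ2 hcβ0 hβlow'
    hβ0 hl01 hc' hc'1 hg hc'2 hCp0.le hs₀0 hκs₀ hL hconcl hp hd2 hd3 hsb0 hsh0 hsl0 hYhX₀ hYlX₀
    (norm_nonneg (X - Yb)) (norm_nonneg (X - Yh)) (norm_nonneg _) hYhX hYlX hD
    (by rw [hll', hlb', hlh']; ring) hGbid hGhid hGlid (by linarith) hup (by linarith) he hlow
    (hec.trans (hscale _ hcg)) with h | h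
  · exact (hscale _ hcc').trans h
  · exact (hscale _ hcg).trans h

/-! ### Lipschitz bounds for the graph of a refractor -/

theorem norm_dir_le_one {n : ℕ} (X : Space n) : ‖dir X‖ ≤ 1 := by
  by_cases hX : X = 0
  · simp [dir, hX]
  · exact (norm_dir hX).le

theorem norm_dir_sub_dir_le {n : ℕ} {X : Space n} (hX : X ≠ 0) (Z : Space n) :
    ‖dir X - dir Z‖ ≤ 2 / ‖X‖ * ‖X - Z‖ := by
  have h0 : 0 < ‖X‖ := norm_pos_iff.2 hX
  have h1 : ‖X‖ • (dir X - dir Z) = (X - Z) + (‖Z‖ - ‖X‖) • dir Z := by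
    rw [smul_sub, sub_smul, norm_smul_dir, norm_smul_dir]; abel
  have h2 : ‖X‖ * ‖dir X - dir Z‖ ≤ 2 * ‖X - Z‖ := by
    have : ‖X‖ * ‖dir X - dir Z‖ = ‖‖X‖ • (dir X - dir Z)‖ := by rw [norm_smul, norm_norm]
    rw [this, h1]
    refine (norm_add_le _ _).trans ?_
    rw [norm_smul, Real.norm_eq_abs]
    have h3 := abs_norm_sub_norm_le Z X
    rw [norm_sub_rev] at h3
    nlinarith [norm_dir_le_one Z, norm_nonneg (dir Z), abs_nonneg (‖Z‖ - ‖X‖)]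
  rw [div_mul_eq_mul_div, le_div_iff₀ h0]
  linarith

theorem IsRefractor.graphPt_mem (hu : IsRefractor κ c₁ c₂ Ω T u) {x : Space n} (hx : x ∈ Ω) :
    graphPt u x ∈ Gam c₁ c₂ Ω := ⟨x, hx, u x, hu.1 x hx, rfl⟩

theorem IsRefractor.mem_subdiff_iff (hu : IsRefractor κ c₁ c₂ Ω T u) (hκ0 : 0 < κ) (hκ1 : κ < 1)
    (hc₁ : 0 < c₁) (hΩ : Ω ⊆ unitSphere n) {x₀ Y : Space n} :
    Y ∈ subdiff κ Ω T u x₀ ↔ Y ∈ T ∧ ∀ x ∈ Ω,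
      opticalLength κ Y (graphPt u x₀) ≤ opticalLength κ Y (graphPt u x) :=
  NearField.mem_subdiff_iff hκ0 hκ1 hΩ fun x hx => hc₁.le.trans (hu.1 x hx).1

/-- Refractors are Lipschitz. -/
theorem IsRefractor.abs_sub_le (hu : IsRefractor κ c₁ c₂ Ω T u) (hκ0 : 0 < κ) (hκ1 : κ < 1)
    (hc₁ : 0 < c₁) (hΩ : Ω ⊆ unitSphere n) {x y : Space n} (hx : x ∈ Ω) (hy : y ∈ Ω) :
    |u x - u y| ≤ κ * c₂ / (1 - κ) * ‖x - y‖ := by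
  have key : ∀ x ∈ Ω, ∀ y ∈ Ω, u y - u x ≤ κ * c₂ / (1 - κ) * ‖x - y‖ := by
    intro x hx y hy
    have hx1 : ‖x‖ = 1 := by simpa using hΩ hx
    have hy1 : ‖y‖ = 1 := by simpa using hΩ hy
    obtain ⟨hux1, hux2⟩ := hu.1 x hx
    obtain ⟨huy1, huy2⟩ := hu.1 y hy
    have h1κ : 0 < 1 - κ := by linarith
    have hc₂ : 0 ≤ c₂ := by linarith
    by_cases hle : u y ≤ u x
    · have : 0 ≤ κ * c₂ / (1 - κ) * ‖x - y‖ := by positivity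
      linarith
    push Not at hle
    -- Minimality above `y` for this `Y` is played against the slope `1 - κ` on the ray through `y`,
    -- between the radii `u x` and `u y`.
    obtain ⟨Y, hY⟩ := hu.2 y hy
    have h1 := ((hu.mem_subdiff_iff hκ0 hκ1 hc₁ hΩ).1 hY).2 x hx
    have h2 := slope_le_opticalLength_sub hκ0 hy1 Y hle.le
    have h3 : ‖u x • x - Y‖ ≤ c₂ * ‖x - y‖ + ‖u x • y - Y‖ := by
      have e : u x • x - Y = u x • (x - y) + (u x • y - Y) := by rw [smul_sub]; abel
      rw [e]
      refine (norm_add_le _ _).trans ?_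
      rw [norm_smul, Real.norm_of_nonneg (by linarith)]
      gcongr
    simp only [opticalLength, graphPt] at h1
    rw [norm_smul, norm_smul, hx1, hy1, mul_one, mul_one, Real.norm_of_nonneg (by linarith),
      Real.norm_of_nonneg (by linarith)] at h1
    have h4 := mul_le_mul_of_nonneg_left h3 hκ0.le
    rw [div_mul_eq_mul_div, le_div_iff₀ h1κ]
    linarith
  rw [abs_le]
  have h1 := key x hx y hy
  have h2 := key y hy x hx
  rw [norm_sub_rev] at h2
  constructor <;> linarith

theorem IsRefractor.exists_norm_graphPt_sub_le (hu : IsRefractor κ c₁ c₂ Ω T u) (hκ0 : 0 < κ)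
    (hκ1 : κ < 1) (hc₁ : 0 < c₁) (hc₂ : c₁ < c₂) (hΩ : Ω ⊆ unitSphere n) :
    ∃ L > 0, ∀ x ∈ Ω, ∀ y ∈ Ω, ‖graphPt u x - graphPt u y‖ ≤ L * ‖x - y‖ := by
  have h1κ : 0 < 1 - κ := by linarith
  have hc₂0 : 0 < c₂ := hc₁.trans hc₂
  refine ⟨c₂ + κ * c₂ / (1 - κ), by positivity, fun x hx y hy => ?_⟩
  have hy1 : ‖y‖ = 1 := by simpa using hΩ hy
  have e : graphPt u x - graphPt u y = u x • (x - y) + (u x - u y) • y := by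
    unfold graphPt; module
  rw [e]
  refine (norm_add_le _ _).trans ?_
  rw [norm_smul, norm_smul, hy1, mul_one, Real.norm_eq_abs (u x - u y), add_mul,
    Real.norm_of_nonneg (hc₁.le.trans (hu.1 x hx).1)]
  have := (hu.1 x hx).2
  have := hu.abs_sub_le hκ0 hκ1 hc₁ hΩ hx hy
  gcongr

theorem IsRefractor.norm_sub_le_graphPt (hu : IsRefractor κ c₁ c₂ Ω T u)
    (hc₁ : 0 < c₁) (hΩ : Ω ⊆ unitSphere n) {x y : Space n} (hx : x ∈ Ω) (hy : y ∈ Ω) :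
    ‖x - y‖ ≤ 2 / c₁ * ‖graphPt u x - graphPt u y‖ := by
  have hx1 : ‖x‖ = 1 := by simpa using hΩ hx
  have hy1 : ‖y‖ = 1 := by simpa using hΩ hy
  have hux := (hu.1 x hx).1
  have hn : ‖graphPt u x‖ = u x := by
    rw [graphPt, norm_smul, hx1, mul_one, Real.norm_of_nonneg (by linarith)]
  have h1 := norm_dir_sub_dir_le (X := graphPt u x) (by
    rw [← norm_pos_iff, hn]; linarith) (graphPt u y)
  rw [hn] at h1
  unfold graphPt at h1 ⊢
  rw [dir_smul_unit (hc₁.trans_le hux) hx1, dir_smul_unit (hc₁.trans_le (hu.1 y hy).1) hy1] at h1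
  refine h1.trans ?_
  gcongr

/-! ### Localization and Hölder continuity of the refractor map -/

/-- Mixed second difference of the optical length. -/
theorem exists_mixed_opticalLength_le (hκ0 : 0 < κ) (hc₁ : 0 < c₁) (hc₂ : c₁ < c₂)
    (hΩ : Ω ⊆ unitSphere n) (hA : HypA κ c₁ c₂ Ω T E s) (hB : HypB κ c₁ c₂ Ω T) :
    ∃ C > 0, ∀ X ∈ Gam c₁ c₂ Ω, ∀ X' ∈ Gam c₁ c₂ Ω, ∀ Y ∈ T, ∀ Y' ∈ T,
      |(opticalLength κ Y X - opticalLength κ Y X') -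
        (opticalLength κ Y' X - opticalLength κ Y' X')| ≤ C * ‖X - X'‖ * ‖Y - Y'‖ := by
  have hc₂0 : 0 < c₂ := hc₁.trans hc₂
  refine ⟨κ * (2 / (c₂ / κ)), by positivity, fun X hX X' hX' Y hY Y' hY' => ?_⟩
  have hd : ∀ X ∈ Gam c₁ c₂ Ω, ∀ Y ∈ T, c₂ / κ ≤ ‖X - Y‖ := fun X hX Y hY => by
    rw [div_le_iff₀' hκ0, norm_sub_rev]; exact hB.le_dist hA hκ0 hc₁ hc₂ hΩ hX hY
  have := abs_mixed_dist_le (by positivity) (hd X hX Y hY) (hd X' hX' Y hY) (hd X hX Y' hY')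
    (hd X' hX' Y' hY')
  have e : (opticalLength κ Y X - opticalLength κ Y X') -
      (opticalLength κ Y' X - opticalLength κ Y' X') =
      κ * ((‖X - Y‖ - ‖X' - Y‖) - (‖X - Y'‖ - ‖X' - Y'‖)) := by
    unfold opticalLength; ring
  rw [e, abs_mul, abs_of_pos hκ0, mul_assoc, mul_assoc, ← mul_assoc _ ‖X - X'‖]
  gcongr

/-- The targets near the middle of `[Ȳ, Ŷ]_{X₀}` are images of points near `x̄`. -/
theorem exists_thickening_subset (hκ0 : 0 < κ) (hκ1 : κ < 1) (hc₁ : 0 < c₁) (hc₂ : c₁ < c₂)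
    (hΩ : Ω ⊆ unitSphere n) (hA : HypA κ c₁ c₂ Ω T E s) (hB : HypB κ c₁ c₂ Ω T)
    (hC : HypC κ c₁ c₂ Ω E s) (hu : IsRefractor κ c₁ c₂ Ω T u) :
    ∃ C₁ > 0, ∃ a > 0, ∃ K > 0, ∀ xb ∈ Ω, ∀ xh ∈ Ω, ∀ Yb ∈ subdiff κ Ω T u xb,
      ∀ Yh ∈ subdiff κ Ω T u xh, ∀ σ > 0, C₁ * ‖xb - xh‖ ≤ σ ^ 2 * ‖Yb - Yh‖ →
      Metric.ball xb (K * σ) ∩ unitSphere n ⊆ Ω →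
      Metric.thickening (a * ‖Yb - Yh‖ ^ 2 * σ)
          (targetCurvePt κ s (graphPt u xb) Yb Yh '' Set.Icc (1 / 4) (3 / 4)) ∩ T ⊆
        ⋃ x ∈ Metric.ball xb (K * σ) ∩ unitSphere n, subdiff κ Ω T u x := by
  obtain ⟨c, hc, hmax⟩ := exists_maximum_principle hκ0 hκ1 hc₁ hc₂ hΩ hA hB hC
  obtain ⟨Cm, hCm, hmix⟩ := exists_mixed_opticalLength_le hκ0 hc₁ hc₂ hΩ hA hB
  obtain ⟨L, hL, hlip⟩ := hu.exists_norm_graphPt_sub_le hκ0 hκ1 hc₁ hc₂ hΩ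
  -- `C₁` puts the error in the minimality of `Ŷ` below the gain, and `a` does the same for the cost
  -- of moving the target off the curve. Projecting to the sphere has Lipschitz constant `2/c₁`,
  -- doubled to pass to an open ball.
  refine ⟨Cm * L / c, by positivity, c / Cm, by positivity, 4 / c₁, by positivity, ?_⟩
  intro xb hxb xh hxh Yb hYb Yh hYh σ hσ hεσ hball Y hY
  obtain ⟨hYth, hYT⟩ := hY
  rw [Metric.mem_thickening_iff] at hYth
  obtain ⟨_, ⟨l, hl, rfl⟩, hYl⟩ := hYth
  obtain ⟨hYbT, hYbmin⟩ := (hu.mem_subdiff_iff hκ0 hκ1 hc₁ hΩ).1 hYb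
  obtain ⟨hYhT, hYhmin⟩ := (hu.mem_subdiff_iff hκ0 hκ1 hc₁ hΩ).1 hYh
  have hX₀ := hu.graphPt_mem hxb
  have hXh := hu.graphPt_mem hxh
  have hYlT : targetCurvePt κ s (graphPt u xb) Yb Yh l ∈ T := by
    refine hA.mem_target hX₀ (hA.convex _ hX₀ _ (hA.polar hX₀ hYbT).1 _ (hA.polar hX₀ hYhT).1 ?_)
    exact ⟨l, ⟨by linarith [hl.1], by linarith [hl.2]⟩, rfl⟩
  have hfar : ∀ x ∈ Ω, σ ≤ ‖graphPt u x - graphPt u xb‖ →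
      opticalLength κ Y (graphPt u xb) ≤ opticalLength κ Y (graphPt u x) := by
    intro x hx hσx
    have hX := hu.graphPt_mem hx
    set δ := ‖Yb - Yh‖
    set w := ‖graphPt u x - graphPt u xb‖
    have hδ : 0 ≤ δ := norm_nonneg _
    have hw : 0 < w := hσ.trans_le hσx
    -- Comparing with `Ȳ`, which is minimal above `x̄`, shows that passing from `x̂` to `x̄` raises
    -- the length to `Ŷ` by at most the mixed difference.
    have hm1 := (abs_le.1 (hmix _ hX₀ _ hXh _ hYbT _ hYhT)).1
    have hl1 : Cm * ‖graphPt u xb - graphPt u xh‖ * δ ≤ Cm * (L * ‖xb - xh‖) * δ := by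
      gcongr; exact hlip _ hxb _ hxh
    have hb1 := hYbmin xh hxh
    have hh1 := hYhmin x hx
    have he : Cm * (L * ‖xb - xh‖) * δ ≤ c * δ ^ 2 * w ^ 2 := by
      have h1 : Cm * L * ‖xb - xh‖ ≤ c * (σ ^ 2 * δ) := by
        have := mul_le_mul_of_nonneg_left hεσ hc.le
        calc _ = c * (Cm * L / c * ‖xb - xh‖) := by field_simp
          _ ≤ _ := this
      calc Cm * (L * ‖xb - xh‖) * δ = Cm * L * ‖xb - xh‖ * δ := by ring
        _ ≤ c * (σ ^ 2 * δ) * δ := by gcongr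
        _ ≤ c * (w ^ 2 * δ) * δ := by gcongr
        _ = _ := by ring
    have hgain := hmax _ hX₀ _ hX _ hYbT _ hYhT l hl (Cm * (L * ‖xb - xh‖) * δ) (by positivity)
      (hYbmin x hx) (by linarith) he
    have hm2 := (abs_le.1 (hmix _ hX _ hX₀ _ hYT _ hYlT)).1
    have hη : Cm * w * ‖Y - targetCurvePt κ s (graphPt u xb) Yb Yh l‖ ≤ c * δ ^ 2 * w ^ 2 := by
      rw [← dist_eq_norm]
      calc Cm * w * dist Y (targetCurvePt κ s (graphPt u xb) Yb Yh l)
          ≤ Cm * w * (c / Cm * δ ^ 2 * σ) := by gcongr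
        _ ≤ Cm * w * (c / Cm * δ ^ 2 * w) := by gcongr
        _ = _ := by field_simp
    linarith
  have hsub : Metric.closedBall xb (2 / c₁ * σ) ∩ unitSphere n ⊆
      Metric.ball xb (4 / c₁ * σ) ∩ unitSphere n := by
    refine Set.inter_subset_inter_left _ (Metric.closedBall_subset_ball ?_)
    have : 0 < 2 / c₁ * σ := by positivity
    have e : 4 / c₁ * σ = 2 * (2 / c₁ * σ) := by ring
    linarith
  have hcomp : IsCompact (Metric.closedBall xb (2 / c₁ * σ) ∩ unitSphere n) :=
    (isCompact_closedBall _ _).inter_right Metric.isClosed_sphere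
  have hgc : ContinuousOn (graphPt u) Ω := by
    have : LipschitzOnWith (Real.toNNReal L) (graphPt u) Ω := by
      refine LipschitzOnWith.of_dist_le_mul fun x hx y hy => ?_
      rw [Real.coe_toNNReal _ hL.le, dist_eq_norm, dist_eq_norm]
      exact hlip x hx y hy
    exact this.continuousOn
  have hcont : ContinuousOn (fun x => opticalLength κ Y (graphPt u x))
      (Metric.closedBall xb (2 / c₁ * σ) ∩ unitSphere n) := by
    have h1 : Continuous (opticalLength κ Y) := by unfold opticalLength; fun_prop
    exact h1.comp_continuousOn (hgc.mono (hsub.trans hball))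
  have hxbmem : xb ∈ Metric.closedBall xb (2 / c₁ * σ) ∩ unitSphere n :=
    ⟨Metric.mem_closedBall_self (by positivity), hΩ hxb⟩
  -- By `hfar`, no point outside this compact cap beats `x̄`, so the minimum over the cap is global
  -- and `Y ∈ ∂u(z)`.
  obtain ⟨z, hz, hzmin⟩ := hcomp.exists_isMinOn ⟨xb, hxbmem⟩ hcont
  refine Set.mem_biUnion (hsub hz) ((hu.mem_subdiff_iff hκ0 hκ1 hc₁ hΩ).2 ⟨hYT, fun x hx => ?_⟩)
  by_cases hxP : x ∈ Metric.closedBall xb (2 / c₁ * σ) ∩ unitSphere n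
  · exact hzmin hxP
  · refine (hzmin hxbmem).trans (hfar x hx ?_)
    by_contra hlt
    push Not at hlt
    refine hxP ⟨?_, hΩ hx⟩
    rw [Metric.mem_closedBall, dist_eq_norm]
    refine (hu.norm_sub_le_graphPt hc₁ hΩ hx hxb).trans ?_
    gcongr

/-- Optimization over the scale `σ`. -/
theorem pow_le_of_scale {k : ℕ} {δ M C₁ C₂ σ₀ ε : ℝ} (hδ : 0 < δ) (hδM : δ ≤ M) (hC₁ : 0 < C₁)
    (hσ₀ : 0 < σ₀) (hε : 0 < ε)
    (h : ∀ σ, 0 < σ → σ ≤ σ₀ → C₁ * ε ≤ σ ^ 2 * δ → δ ^ (2 * k + 1) ≤ C₂ * σ) :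
    δ ^ (4 * k + 3) ≤ (C₂ ^ 2 * C₁ + M ^ (4 * k + 2) * (C₁ / σ₀ ^ 2)) * ε := by
  have hσ2 : √(C₁ * ε / δ) ^ 2 = C₁ * ε / δ := Real.sq_sqrt (by positivity)
  have hσ0 : 0 < √(C₁ * ε / δ) := Real.sqrt_pos.2 (by positivity)
  have hM : 0 < M := hδ.trans_le hδM
  -- The smallest admissible scale is the best choice. When it exceeds `σ₀`, already `δ ≲ ε`, and
  -- the other powers of `δ` are bounded by those of `M`.
  by_cases hle : √(C₁ * ε / δ) ≤ σ₀
  · have h1 := h _ hσ0 hle (by rw [hσ2]; field_simp; exact le_rfl)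
    have h2 : (δ ^ (2 * k + 1)) ^ 2 ≤ (C₂ * √(C₁ * ε / δ)) ^ 2 :=
      pow_le_pow_left₀ (by positivity) h1 2
    rw [mul_pow, hσ2] at h2
    have h3 : δ ^ (4 * k + 3) ≤ C₂ ^ 2 * C₁ * ε := by
      calc δ ^ (4 * k + 3) = (δ ^ (2 * k + 1)) ^ 2 * δ := by ring
        _ ≤ C₂ ^ 2 * (C₁ * ε / δ) * δ := by gcongr
        _ = _ := by field_simp
    have : 0 ≤ M ^ (4 * k + 2) * (C₁ / σ₀ ^ 2) * ε := by positivity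
    linarith
  · push Not at hle
    have h1 : σ₀ ^ 2 ≤ C₁ * ε / δ := hσ2 ▸ pow_le_pow_left₀ hσ₀.le hle.le 2
    have h2 : δ ≤ C₁ / σ₀ ^ 2 * ε := by
      rw [le_div_iff₀ hδ] at h1
      rw [div_mul_eq_mul_div, le_div_iff₀ (by positivity)]
      linarith
    have h3 : δ ^ (4 * k + 3) ≤ M ^ (4 * k + 2) * (C₁ / σ₀ ^ 2 * ε) := by
      rw [pow_succ]
      gcongr
    have : 0 ≤ C₂ ^ 2 * C₁ * ε := by positivity
    linarith

/-- The lower measure bound of H.D on the thickened middle curve meets the upper bound on `∂u` of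
the ball containing its preimages. With `k = n - 2` the exponent is `4k + 3 = 4n - 5`. -/
theorem exists_pow_norm_sub_le (hn : 2 ≤ n) (hκ0 : 0 < κ) (hκ1 : κ < 1) (hc₁ : 0 < c₁)
    (hc₂ : c₁ < c₂) (hΩ : ∃ U : Set (Space n), IsOpen U ∧ Ω = U ∩ unitSphere n)
    (hA : HypA κ c₁ c₂ Ω T E s) (hB : HypB κ c₁ c₂ Ω T)
    (hC : HypC κ c₁ c₂ Ω E s) (hD : HypD κ c₁ c₂ Ω T s) (hu : IsRefractor κ c₁ c₂ Ω T u)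
    (hmeas : MeasureBound κ Ω T u) {K : Set (Space n)} (hK : IsCompact K) (hKΩ : K ⊆ Ω) :
    ∃ B, ∀ xb ∈ K, ∀ xh ∈ K, ∀ Yb ∈ subdiff κ Ω T u xb, ∀ Yh ∈ subdiff κ Ω T u xh,
      ‖Yb - Yh‖ ^ (4 * (n - 2) + 3) ≤ B * ‖xb - xh‖ := by
  obtain ⟨U, hU, hUΩ⟩ := hΩ
  have hΩs : Ω ⊆ unitSphere n := by rw [hUΩ]; exact Set.inter_subset_right
  obtain ⟨k, rfl⟩ : ∃ k, n = k + 2 := ⟨n - 2, by omega⟩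
  obtain ⟨C₁, hC₁, a, ha, R, hR, hsub⟩ :=
    exists_thickening_subset hκ0 hκ1 hc₁ hc₂ hΩs hA hB hC hu
  obtain ⟨S, hS, hSd⟩ := hA.exists_dist_le hc₁ hΩs
  obtain ⟨μ₀, hμ₀, C, hC0, hDm⟩ := hD
  obtain ⟨C', hC'⟩ := hmeas
  obtain ⟨r, hr, hrU⟩ := hK.exists_thickening_subset_open hU
    (hKΩ.trans (by rw [hUΩ]; exact Set.inter_subset_left))
  obtain ⟨σ₀, hσ₀, hσr, hσμ⟩ : ∃ σ₀ > 0, R * σ₀ ≤ r ∧ a * (2 * S) ^ 2 * σ₀ ≤ μ₀ :=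
    ⟨min (r / R) (μ₀ / (a * (2 * S) ^ 2)), lt_min (by positivity) (by positivity),
      by rw [← le_div_iff₀' hR]; exact min_le_left _ _,
      by rw [← le_div_iff₀' (by positivity)]; exact min_le_right _ _⟩
  obtain ⟨C₂, hC₂⟩ : ∃ C₂, C₂ = C' * R ^ (k + 1) / (C * a ^ k) := ⟨_, rfl⟩
  obtain ⟨B, hBdef⟩ : ∃ B, B = C₂ ^ 2 * C₁ + (2 * S) ^ (4 * k + 2) * (C₁ / σ₀ ^ 2) := ⟨_, rfl⟩
  have hB0 : 0 < B := by rw [hBdef]; positivity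
  refine ⟨B, ?_⟩
  intro xb hxb xh hxh Yb hYb Yh hYh
  rw [Nat.add_sub_cancel]
  rcases (norm_nonneg (Yb - Yh)).eq_or_lt with h0 | hδ
  · rw [← h0, zero_pow (by omega)]; positivity
  have hX₀ := hu.graphPt_mem (hKΩ hxb)
  have hδM : ‖Yb - Yh‖ ≤ 2 * S := by
    have e : Yb - Yh = (Yb - graphPt u xb) - (Yh - graphPt u xb) := by abel
    rw [e]
    refine (norm_sub_le _ _).trans ?_
    linarith [hSd _ hX₀ _ hYb.1, hSd _ hX₀ _ hYh.1]
  -- A positive `ε` replaces `|x̄ - x̂|` so that the scale stays positive when `x̄ = x̂`; that case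
  -- later gives uniqueness of the focus.
  have key : ∀ ε : ℝ, 0 < ε → ‖xb - xh‖ ≤ ε → ‖Yb - Yh‖ ^ (4 * k + 3) ≤ B * ε := by
    intro ε hε hle
    rw [hBdef]
    refine pow_le_of_scale hδ hδM hC₁ hσ₀ hε fun σ hσ hσσ₀ hσδ => ?_
    have hball : Metric.ball xb (R * σ) ∩ unitSphere (k + 2) ⊆ Ω := by
      rw [hUΩ]
      refine Set.inter_subset_inter_left _ (subset_trans ?_ hrU)
      refine (Metric.ball_subset_ball ?_).trans (Metric.ball_subset_thickening hxb r)
      exact (mul_le_mul_of_nonneg_left hσσ₀ hR.le).trans hσr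
    have hinc := hsub xb (hKΩ hxb) xh (hKΩ hxh) Yb hYb Yh hYh σ hσ
      ((mul_le_mul_of_nonneg_left hle hC₁.le).trans hσδ) hball
    have h1 := hDm _ hX₀ Yb hYb.1 Yh hYh.1 (a * ‖Yb - Yh‖ ^ 2 * σ) (by positivity)
      (le_trans (by gcongr) hσμ)
    have h2 := hC' xb (hΩs (hKΩ hxb)) (R * σ) (by positivity) hball
    have h3 := h1.trans ((MeasureTheory.measure_mono hinc).trans h2)
    have hk1 : k + 2 - 2 = k := by omega
    have hk2 : k + 2 - 1 = k + 1 := by omega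
    rw [hk1, hk2] at h3
    have h4 : C * (a * ‖Yb - Yh‖ ^ 2 * σ) ^ k * ‖Yb - Yh‖ ≤ C' * (R * σ) ^ (k + 1) := by
      -- Positivity of the left side excludes truncation by `ENNReal.ofReal`, so no sign of `C'` is
      -- needed.
      rcases ENNReal.ofReal_le_ofReal_iff'.1 h3 with h | h
      · exact h
      · have : 0 < C * (a * ‖Yb - Yh‖ ^ 2 * σ) ^ k * ‖Yb - Yh‖ := by positivity
        linarith
    have h5 : σ ^ k * (C * a ^ k * ‖Yb - Yh‖ ^ (2 * k + 1)) ≤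
        σ ^ k * (C' * R ^ (k + 1) * σ) := by
      calc _ = C * (a * ‖Yb - Yh‖ ^ 2 * σ) ^ k * ‖Yb - Yh‖ := by
            rw [mul_pow, mul_pow, ← pow_mul]; ring
        _ ≤ _ := h4
        _ = _ := by rw [mul_pow]; ring
    have h6 := le_of_mul_le_mul_left h5 (by positivity)
    rw [hC₂, div_mul_eq_mul_div, le_div_iff₀ (by positivity)]
    linarith
  refine le_of_forall_pos_le_add fun ε hε => ?_
  have h1 : 0 < ‖xb - xh‖ + ε / B := by positivity
  have := key (‖xb - xh‖ + ε / B) h1 (by linarith [div_pos hε hB0])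
  rwa [mul_add, mul_div_cancel₀ _ hB0.ne'] at this

/-- Hölder continuity of the refractor map. -/
theorem exists_norm_sub_le_rpow (hn : 2 ≤ n) (hκ0 : 0 < κ) (hκ1 : κ < 1) (hc₁ : 0 < c₁)
    (hc₂ : c₁ < c₂) (hΩ : ∃ U : Set (Space n), IsOpen U ∧ Ω = U ∩ unitSphere n)
    (hA : HypA κ c₁ c₂ Ω T E s) (hB : HypB κ c₁ c₂ Ω T)
    (hC : HypC κ c₁ c₂ Ω E s) (hD : HypD κ c₁ c₂ Ω T s) (hu : IsRefractor κ c₁ c₂ Ω T u)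
    (hmeas : MeasureBound κ Ω T u) {K : Set (Space n)} (hK : IsCompact K) (hKΩ : K ⊆ Ω) :
    ∃ C, 0 ≤ C ∧ ∀ xb ∈ K, ∀ xh ∈ K, ∀ Yb ∈ subdiff κ Ω T u xb, ∀ Yh ∈ subdiff κ Ω T u xh,
      ‖Yb - Yh‖ ≤ C * ‖xb - xh‖ ^ (1 / (4 * (n : ℝ) - 5)) := by
  obtain ⟨B, hB'⟩ := exists_pow_norm_sub_le hn hκ0 hκ1 hc₁ hc₂ hΩ hA hB hC hD hu hmeas hK hKΩ
  refine ⟨|B| ^ (1 / (4 * (n : ℝ) - 5)), by positivity, ?_⟩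
  intro xb hxb xh hxh Yb hYb Yh hYh
  have h1 := hB' xb hxb xh hxh Yb hYb Yh hYh
  have h2 : ‖Yb - Yh‖ ^ (4 * (n - 2) + 3) ≤ |B| * ‖xb - xh‖ :=
    h1.trans (mul_le_mul_of_nonneg_right (le_abs_self B) (norm_nonneg _))
  have hcast : ((4 * (n - 2) + 3 : ℕ) : ℝ) = 4 * (n : ℝ) - 5 := by
    push_cast [Nat.cast_sub hn]; ring
  have hα : 0 ≤ 1 / (4 * (n : ℝ) - 5) := by
    rw [← hcast]; positivity
  rw [← Real.mul_rpow (abs_nonneg B) (norm_nonneg _),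
    ← Real.pow_rpow_inv_natCast (norm_nonneg (Yb - Yh)) (show 4 * (n - 2) + 3 ≠ 0 by omega), hcast,
    ← one_div]
  exact Real.rpow_le_rpow (by positivity) h2 hα

/-! ### Gradients of ovals and of the refractor -/

/-- The factor `|Z| - κ Z · x` with `Z = Y - ρ x`. -/
def obliquity (κ : ℝ) (x Z : Space n) : ℝ := ‖Z‖ - κ * ⟪Z, x⟫

theorem le_obliquity (hκ0 : 0 < κ) {x : Space n} (hx : ‖x‖ = 1) (Z : Space n) :
    (1 - κ) * ‖Z‖ ≤ obliquity κ x Z := by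
  have h1 := real_inner_le_norm Z x
  rw [hx, mul_one] at h1
  have := mul_le_mul_of_nonneg_left h1 hκ0.le
  unfold obliquity
  linarith

/-- The gradient of the polar radius of an oval at the point through which it is drawn. -/
theorem hasGradientAt_h (hκ0 : 0 < κ) (hκ1 : κ < 1) {x₀ Y : Space n} {ρ : ℝ} (hx₀ : ‖x₀‖ = 1)
    (hρ : 0 < ρ) (hY : 0 < ‖Y - ρ • x₀‖) :
    HasGradientAt (fun x => h κ x Y (ρ • x₀))
      ((κ * ρ / obliquity κ x₀ (Y - ρ • x₀)) • Y) x₀ := by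
  have hk : 0 < 1 - κ ^ 2 := sub_pos.2 (pow_lt_one₀ hκ0.le hκ1 two_ne_zero)
  have hq : 0 < obliquity κ x₀ (Y - ρ • x₀) :=
    (mul_pos (by linarith) hY).trans_le (le_obliquity hκ0 hx₀ _)
  have hqdef : obliquity κ x₀ (Y - ρ • x₀) = ‖Y - ρ • x₀‖ - κ * (⟪x₀, Y⟫ - ρ) := by
    rw [obliquity, inner_sub_left, inner_smul_left, real_inner_self_eq_norm_sq, hx₀,
      real_inner_comm]
    simp
  obtain ⟨q, hqe⟩ : ∃ q, q = obliquity κ x₀ (Y - ρ • x₀) := ⟨_, rfl⟩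
  have hb : ‖ρ • x₀‖ + κ * ‖ρ • x₀ - Y‖ = ρ + κ * ‖Y - ρ • x₀‖ := by
    rw [norm_sub_rev, norm_smul, hx₀, mul_one, Real.norm_of_nonneg hρ.le]
  have htsq : ‖Y - ρ • x₀‖ ^ 2 = ‖Y‖ ^ 2 - 2 * ρ * ⟪x₀, Y⟫ + ρ ^ 2 := by
    rw [norm_sub_sq_real, inner_smul_right, norm_smul, hx₀, mul_one, Real.norm_of_nonneg hρ.le,
      real_inner_comm]
    ring
  rw [← hqe] at hq hqdef ⊢
  set t := ‖Y - ρ • x₀‖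
  set b := ρ + κ * t with hbdef
  have hB₀ : b - κ ^ 2 * ⟪x₀, Y⟫ = κ * q + (1 - κ ^ 2) * ρ := by rw [hbdef, hqdef]; ring
  -- At the base point the discriminant is a perfect square, positive since the obliquity is, so the
  -- square root is differentiable there.
  have hdisc : (b - κ ^ 2 * ⟪x₀, Y⟫) ^ 2 - (1 - κ ^ 2) * (b ^ 2 - κ ^ 2 * ‖Y‖ ^ 2) =
      (κ * q) ^ 2 := by
    rw [hbdef, hqdef]
    linear_combination (-(κ ^ 2 * (1 - κ ^ 2))) * htsq
  have hin : HasFDerivAt (fun x : Space n => b - κ ^ 2 * ⟪x, Y⟫)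
      (-(κ ^ 2 • innerSL ℝ Y)) x₀ := by
    have h1 : HasFDerivAt (fun x : Space n => ⟪x, Y⟫) (innerSL ℝ Y) x₀ := by
      have := (innerSL ℝ Y).hasFDerivAt (x := x₀)
      refine this.congr_of_eventuallyEq (Filter.Eventually.of_forall fun x => ?_)
      simp [real_inner_comm]
    exact (h1.const_mul (κ ^ 2)).const_sub b
  have hout : HasDerivAt (fun B : ℝ => (B - √(B ^ 2 - (1 - κ ^ 2) * (b ^ 2 - κ ^ 2 * ‖Y‖ ^ 2))) /
      (1 - κ ^ 2)) (-(ρ / (κ * q))) (b - κ ^ 2 * ⟪x₀, Y⟫) := by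
    have h1 : HasDerivAt (fun B : ℝ => B ^ 2 - (1 - κ ^ 2) * (b ^ 2 - κ ^ 2 * ‖Y‖ ^ 2))
        (2 * (b - κ ^ 2 * ⟪x₀, Y⟫)) (b - κ ^ 2 * ⟪x₀, Y⟫) := by
      simpa using (hasDerivAt_pow 2 (b - κ ^ 2 * ⟪x₀, Y⟫)).sub_const
        ((1 - κ ^ 2) * (b ^ 2 - κ ^ 2 * ‖Y‖ ^ 2))
    have h2 := h1.sqrt (by rw [hdisc]; positivity)
    have h3 := ((hasDerivAt_id (b - κ ^ 2 * ⟪x₀, Y⟫)).sub h2).div_const (1 - κ ^ 2)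
    refine h3.congr_deriv ?_
    rw [hdisc, Real.sqrt_sq (by positivity), hB₀]
    field_simp
    ring
  rw [hasGradientAt_iff_hasFDerivAt]
  have hcomp := hout.comp_hasFDerivAt x₀ hin
  have hfun : (fun x => h κ x Y (ρ • x₀)) =
      (fun B : ℝ => (B - √(B ^ 2 - (1 - κ ^ 2) * (b ^ 2 - κ ^ 2 * ‖Y‖ ^ 2))) / (1 - κ ^ 2)) ∘
        fun x : Space n => b - κ ^ 2 * ⟪x, Y⟫ := by
    funext x
    simp only [h, ovalRadius, hb, Function.comp_apply]
  rw [hfun]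
  refine hcomp.congr_fderiv ?_
  ext v
  simp
  field_simp

theorem hasFDerivAt_dir {x₀ : Space n} (hx₀ : ‖x₀‖ = 1) :
    HasFDerivAt (dir : Space n → Space n)
      (ContinuousLinearMap.id ℝ (Space n) - (innerSL ℝ x₀).smulRight x₀) x₀ := by
  have h1 : HasFDerivAt (fun y : Space n => ‖y‖ ^ 2) (2 • innerSL ℝ x₀) x₀ :=
    (hasStrictFDerivAt_norm_sq x₀).hasFDerivAt
  have h2 : HasDerivAt (fun r : ℝ => (√r)⁻¹) (-(1 / 2)) (‖x₀‖ ^ 2) := by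
    rw [hx₀, one_pow]
    have := ((hasDerivAt_id (1 : ℝ)).sqrt one_ne_zero).inv (by simp)
    refine this.congr_deriv ?_
    simp
  have h3 : HasFDerivAt (fun y : Space n => ‖y‖⁻¹) (-(innerSL ℝ x₀)) x₀ := by
    have := h2.comp_hasFDerivAt x₀ h1
    have e : (fun r : ℝ => (√r)⁻¹) ∘ (fun y : Space n => ‖y‖ ^ 2) = fun y : Space n => ‖y‖⁻¹ := by
      funext y
      simp [Real.sqrt_sq (norm_nonneg y)]
    rw [e] at this
    refine this.congr_fderiv ?_
    ext v
    simp
  have h4 := h3.smul (hasFDerivAt_id x₀)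
  refine h4.congr_fderiv ?_
  ext v
  simp [hx₀, sub_eq_add_neg]

/-- The tangential part of the gradient of `k` is the gradient of `k ∘ dir`. -/
theorem hasGradientAt_comp_dir {k : Space n → ℝ} {g x₀ : Space n} (hx₀ : ‖x₀‖ = 1)
    (hk : HasGradientAt k g x₀) :
    HasGradientAt (fun y => k (dir y)) (g - (inner ℝ g x₀) • x₀) x₀ := by
  rw [hasGradientAt_iff_hasFDerivAt] at hk ⊢
  have hd : dir x₀ = x₀ := by rw [dir, hx₀]; simp
  have hk' : HasFDerivAt k ((InnerProductSpace.toDual ℝ (Space n)) g) (dir x₀) := by rwa [hd]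
  refine (hk'.comp x₀ (hasFDerivAt_dir hx₀)).congr_fderiv ?_
  ext v
  simp
  ring

/-- A function within `o(|y - x₀|)` of a differentiable one has the same gradient. -/
theorem hasGradientAt_of_abs_sub_le {f k : Space n → ℝ} {g x₀ : Space n} {C α : ℝ} (hα : 0 < α)
    (hk : HasGradientAt k g x₀)
    (hfk : ∀ᶠ y in nhds x₀, |f y - k y| ≤ C * (‖y - x₀‖ * ‖y - x₀‖ ^ α)) :
    HasGradientAt f g x₀ := by
  rw [hasGradientAt_iff_hasFDerivAt] at hk ⊢
  have h0 : f x₀ - k x₀ = 0 := by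
    have := hfk.self_of_nhds
    rw [sub_self, norm_zero, zero_mul, mul_zero] at this
    exact abs_nonpos_iff.1 this
  have hz : HasFDerivAt (fun y => f y - k y) (0 : Space n →L[ℝ] ℝ) x₀ := by
    rw [hasFDerivAt_iff_isLittleO]
    have h1 : (fun y => f y - k y) =O[nhds x₀] fun y => ‖y - x₀‖ * ‖y - x₀‖ ^ α := by
      refine Asymptotics.IsBigO.of_bound C (hfk.mono fun y hy => ?_)
      rw [Real.norm_eq_abs, Real.norm_of_nonneg (by positivity)]
      exact hy
    have h2 : (fun y : Space n => ‖y - x₀‖ ^ α) =o[nhds x₀] fun _ => (1 : ℝ) := by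
      rw [Asymptotics.isLittleO_one_iff]
      have hc : ContinuousAt (fun y : Space n => ‖y - x₀‖ ^ α) x₀ := by
        refine ContinuousAt.rpow_const (by fun_prop) (Or.inr hα.le)
      have := hc.tendsto
      simpa [Real.zero_rpow hα.ne'] using this
    have h3 : (fun y : Space n => ‖y - x₀‖ * ‖y - x₀‖ ^ α) =o[nhds x₀] fun y => ‖y - x₀‖ := by
      simpa using (Asymptotics.isBigO_refl (fun y : Space n => ‖y - x₀‖) (nhds x₀)).mul_isLittleO h2
    have h4 := (h1.trans_isLittleO h3).of_norm_right
    simpa [h0] using h4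
  have := hk.add hz
  rw [add_zero] at this
  refine this.congr_of_eventuallyEq (Filter.Eventually.of_forall fun y => ?_)
  simp

/-- The tangential gradient at `x` of an oval through `ρ x` whose focus is `ρ x + Z`. -/
def ovalTangent (κ ρ : ℝ) (x Z : Space n) : Space n :=
  (κ * ρ / obliquity κ x Z) • (Z - ⟪Z, x⟫ • x)

theorem tangential_smul_eq_ovalTangent {x Y : Space n} (hx : ‖x‖ = 1) (ρ : ℝ) :
    (κ * ρ / obliquity κ x (Y - ρ • x)) • Y -
        (inner ℝ ((κ * ρ / obliquity κ x (Y - ρ • x)) • Y) x) • x =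
      ovalTangent κ ρ x (Y - ρ • x) := by
  unfold ovalTangent
  rw [inner_smul_left, inner_sub_left, inner_smul_left, real_inner_self_eq_norm_sq, hx]
  simp only [conj_trivial]
  module

/-- Numerator and denominator are Lipschitz on bounded sets and the obliquity is at least `q₀`. The
modulus of continuity of the focus thus passes to the gradient. -/
theorem exists_norm_ovalTangent_sub_le (κ c₂ S q₀ : ℝ) (hκ0 : 0 < κ) (hκ1 : κ < 1) (hS : 0 < S)
    (hq₀ : 0 < q₀) (hc₂ : 0 < c₂) :
    ∃ C, 0 ≤ C ∧ ∀ (x x' Z Z' : Space n) (ρ ρ' η : ℝ), ‖x‖ = 1 → ‖x'‖ = 1 → ‖Z‖ ≤ S → ‖Z'‖ ≤ S →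
      0 ≤ ρ → 0 ≤ ρ' → ρ' ≤ c₂ → q₀ ≤ obliquity κ x Z → q₀ ≤ obliquity κ x' Z' →
      ‖x - x'‖ ≤ η → ‖Z - Z'‖ ≤ η → |ρ - ρ'| ≤ η →
      ‖ovalTangent κ ρ x Z - ovalTangent κ ρ' x' Z'‖ ≤ C * η := by
  refine ⟨(1 / q₀ + c₂ * (2 + S) / q₀ ^ 2) * (2 * S) + c₂ / q₀ * (2 + 2 * S), by positivity, ?_⟩
  intro x x' Z Z' ρ ρ' η hx hx' hZ hZ' hρ hρ' hρc hq hq' hxη hZη hρη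
  have hη : 0 ≤ η := (norm_nonneg _).trans hxη
  have hin : |⟪Z, x⟫ - ⟪Z', x'⟫| ≤ (1 + S) * η := by
    have e : ⟪Z, x⟫ - ⟪Z', x'⟫ = ⟪Z - Z', x⟫ + ⟪Z', x - x'⟫ := by
      rw [inner_sub_left, inner_sub_right]; ring
    rw [e]
    refine (abs_add_le _ _).trans ?_
    have h1 := abs_real_inner_le_norm (Z - Z') x
    have h2 := abs_real_inner_le_norm Z' (x - x')
    rw [hx, mul_one] at h1
    have h3 : ‖Z'‖ * ‖x - x'‖ ≤ S * η := by gcongr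
    linarith
  have hiZ : |⟪Z, x⟫| ≤ S := by
    have h1 := abs_real_inner_le_norm Z x
    rw [hx, mul_one] at h1
    exact h1.trans hZ
  have hP : ‖Z - ⟪Z, x⟫ • x‖ ≤ 2 * S := by
    refine (norm_sub_le _ _).trans ?_
    rw [norm_smul, hx, mul_one, Real.norm_eq_abs]
    linarith
  have hPP : ‖(Z - ⟪Z, x⟫ • x) - (Z' - ⟪Z', x'⟫ • x')‖ ≤ (2 + 2 * S) * η := by
    have e : (Z - ⟪Z, x⟫ • x) - (Z' - ⟪Z', x'⟫ • x') =
        (Z - Z') - (⟪Z, x⟫ • (x - x') + (⟪Z, x⟫ - ⟪Z', x'⟫) • x') := by module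
    rw [e]
    refine (norm_sub_le _ _).trans ?_
    have h1 := norm_add_le (⟪Z, x⟫ • (x - x')) ((⟪Z, x⟫ - ⟪Z', x'⟫) • x')
    rw [norm_smul, norm_smul, hx', mul_one, Real.norm_eq_abs, Real.norm_eq_abs] at h1
    have h2 : |⟪Z, x⟫| * ‖x - x'‖ ≤ S * η := by gcongr
    linarith
  have hqq : |obliquity κ x' Z' - obliquity κ x Z| ≤ (2 + S) * η := by
    have e : obliquity κ x' Z' - obliquity κ x Z =
        (‖Z'‖ - ‖Z‖) + κ * (⟪Z, x⟫ - ⟪Z', x'⟫) := by unfold obliquity; ring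
    rw [e]
    refine (abs_add_le _ _).trans ?_
    rw [abs_mul, abs_of_pos hκ0]
    have h1 := abs_norm_sub_norm_le Z' Z
    rw [norm_sub_rev] at h1
    have h2 : κ * |⟪Z, x⟫ - ⟪Z', x'⟫| ≤ 1 * ((1 + S) * η) := by gcongr
    linarith
  unfold ovalTangent
  generalize obliquity κ x Z = q at *
  generalize obliquity κ x' Z' = q' at *
  have hq0 := hq₀.trans_le hq
  have hq0' := hq₀.trans_le hq'
  have ha : |κ * ρ / q - κ * ρ' / q'| ≤ (1 / q₀ + c₂ * (2 + S) / q₀ ^ 2) * η := by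
    have e : κ * ρ / q - κ * ρ' / q' = κ * ((ρ - ρ') / q + ρ' * (q' - q) / (q * q')) := by
      field_simp; ring
    rw [e, abs_mul, abs_of_pos hκ0]
    have h1 : |(ρ - ρ') / q| ≤ η / q₀ := by
      rw [abs_div, abs_of_pos hq0]; gcongr
    have h2 : |ρ' * (q' - q) / (q * q')| ≤ c₂ * ((2 + S) * η) / q₀ ^ 2 := by
      rw [abs_div, abs_mul, abs_of_nonneg hρ', abs_of_pos (mul_pos hq0 hq0'), sq]
      gcongr
    have h3 := abs_add_le ((ρ - ρ') / q) (ρ' * (q' - q) / (q * q'))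
    calc _ ≤ 1 * |(ρ - ρ') / q + ρ' * (q' - q) / (q * q')| := by gcongr
      _ ≤ η / q₀ + c₂ * ((2 + S) * η) / q₀ ^ 2 := by linarith
      _ = _ := by ring
  have ha' : |κ * ρ' / q'| ≤ c₂ / q₀ := by
    rw [abs_of_nonneg (by positivity)]
    have : κ * ρ' ≤ 1 * c₂ := by gcongr
    rw [one_mul] at this
    gcongr
  have e : (κ * ρ / q) • (Z - ⟪Z, x⟫ • x) - (κ * ρ' / q') • (Z' - ⟪Z', x'⟫ • x') =
      (κ * ρ / q - κ * ρ' / q') • (Z - ⟪Z, x⟫ • x) +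
        (κ * ρ' / q') • ((Z - ⟪Z, x⟫ • x) - (Z' - ⟪Z', x'⟫ • x')) := by module
  rw [e]
  refine (norm_add_le _ _).trans ?_
  rw [norm_smul, norm_smul, Real.norm_eq_abs, Real.norm_eq_abs, add_mul]
  refine add_le_add ?_ ?_
  · calc _ ≤ ((1 / q₀ + c₂ * (2 + S) / q₀ ^ 2) * η) * (2 * S) := by gcongr
      _ = _ := by ring
  · calc _ ≤ c₂ / q₀ * ((2 + 2 * S) * η) := by gcongr
      _ = _ := by ring

theorem dir_eq_self {x : Space n} (hx : ‖x‖ = 1) : dir x = x := by rw [dir, hx]; simp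

theorem exists_compact_eventually_dir_mem
    (hΩ : ∃ U : Set (Space n), IsOpen U ∧ Ω = U ∩ unitSphere n) {x₀ : Space n} (hx₀ : x₀ ∈ Ω) :
    ∃ K ⊆ Ω, IsCompact K ∧ x₀ ∈ K ∧ ∀ᶠ y in nhds x₀, dir y ∈ K := by
  obtain ⟨U, hU, rfl⟩ := hΩ
  have hx1 : ‖x₀‖ = 1 := by simpa using hx₀.2
  obtain ⟨r, hr, hrU⟩ := Metric.isOpen_iff.1 hU x₀ hx₀.1
  refine ⟨Metric.closedBall x₀ (r / 2) ∩ unitSphere n, Set.inter_subset_inter_left _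
    ((Metric.closedBall_subset_ball (by linarith)).trans hrU),
    (isCompact_closedBall _ _).inter_right Metric.isClosed_sphere,
    ⟨Metric.mem_closedBall_self (by positivity), hx₀.2⟩, ?_⟩
  have hc := (hasFDerivAt_dir hx1).continuousAt
  have h1 : Metric.closedBall x₀ (r / 2) ∈ nhds (dir x₀) := by
    rw [dir_eq_self hx1]; exact Metric.closedBall_mem_nhds _ (by positivity)
  have hne : ∀ᶠ y in nhds x₀, y ≠ 0 := by
    refine isOpen_ne.mem_nhds ?_
    rintro rfl
    simp at hx1
  filter_upwards [hc.preimage_mem_nhds h1, hne] with y hy hy0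
  exact ⟨hy, by simpa using norm_dir hy0⟩

/-- If the refractor map is Hölder continuous near `x₀`, then the refractor is differentiable at `x₀`
with the tangential gradient of its supporting oval. -/
theorem IsRefractor.hasGradientAt_radialExt (hu : IsRefractor κ c₁ c₂ Ω T u) (hκ0 : 0 < κ)
    (hκ1 : κ < 1) (hc₁ : 0 < c₁) (hc₂ : c₁ < c₂) (hΩ : Ω ⊆ unitSphere n)
    (hA : HypA κ c₁ c₂ Ω T E s) (hB : HypB κ c₁ c₂ Ω T) {K : Set (Space n)} (hKΩ : K ⊆ Ω)
    {x₀ Y g : Space n} {C α : ℝ} (hα : 0 < α) (hC0 : 0 ≤ C) (hx₀ : x₀ ∈ K)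
    (hev : ∀ᶠ y in nhds x₀, dir y ∈ K) (hY : Y ∈ subdiff κ Ω T u x₀)
    (hhol : ∀ x ∈ K, ∀ Y' ∈ subdiff κ Ω T u x, ‖Y - Y'‖ ≤ C * ‖x - x₀‖ ^ α)
    (hg : HasGradientAt (fun x => h κ x Y (u x₀ • x₀)) g x₀) :
    HasGradientAt (radialExt u) (g - (inner ℝ g x₀) • x₀) x₀ := by
  have hx₀1 : ‖x₀‖ = 1 := by simpa using hΩ (hKΩ hx₀)
  have h1κ : 0 < 1 - κ := by linarith
  obtain ⟨Cm, hCm, hmix⟩ := exists_mixed_opticalLength_le hκ0 hc₁ hc₂ hΩ hA hB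
  obtain ⟨L, hL, hlip⟩ := hu.exists_norm_graphPt_sub_le hκ0 hκ1 hc₁ hc₂ hΩ
  refine hasGradientAt_of_abs_sub_le
    (C := Cm * (L * 2) * (C * 2 ^ α) / (1 - κ)) hα (hasGradientAt_comp_dir hx₀1 hg) ?_
  filter_upwards [hev] with y hy
  have hyΩ := hKΩ hy
  have hy1 : ‖dir y‖ = 1 := by simpa using hΩ hyΩ
  obtain ⟨Y', hY'⟩ := hu.2 _ hyΩ
  obtain ⟨hY'T, hY'min⟩ := (hu.mem_subdiff_iff hκ0 hκ1 hc₁ hΩ).1 hY'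
  have hle : h κ (dir y) Y (u x₀ • x₀) ≤ u (dir y) := hY.2 _ hyΩ
  -- `(1-κ)(u - h)` at `dir y` is at most the increment of the length to `Y` from `x₀`. The
  -- increment to `Y' ∈ ∂u(dir y)` is nonpositive, so the mixed difference bounds it by `|y - x₀| |Y
  -- - Y'|` up to a constant.
  have hslope := slope_le_opticalLength_sub hκ0 hy1 Y hle
  have hspec : h κ (dir y) Y (u x₀ • x₀) + κ * ‖h κ (dir y) Y (u x₀ • x₀) • dir y - Y‖ =
      opticalLength κ Y (graphPt u x₀) := ovalRadius_spec hκ0 hκ1 hy1 Y _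
  have hopt : u (dir y) + κ * ‖u (dir y) • dir y - Y‖ =
      opticalLength κ Y (graphPt u (dir y)) := by
    rw [opticalLength, graphPt, norm_smul, hy1, mul_one,
      Real.norm_of_nonneg (hc₁.le.trans (hu.1 _ hyΩ).1)]
  rw [hspec, hopt] at hslope
  have hm := (abs_le.1 (hmix _ (hu.graphPt_mem hyΩ) _ (hu.graphPt_mem (hKΩ hx₀)) _ hY.1 _ hY'T)).2
  have hmin := hY'min x₀ (hKΩ hx₀)
  have hdir : ‖dir y - x₀‖ ≤ 2 * ‖y - x₀‖ := by
    have hx₀0 : x₀ ≠ 0 := by rw [← norm_pos_iff, hx₀1]; exact one_pos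
    have := norm_dir_sub_dir_le hx₀0 y
    rwa [dir_eq_self hx₀1, hx₀1, div_one, norm_sub_rev x₀ (dir y), norm_sub_rev x₀ y] at this
  have hg1 : ‖graphPt u (dir y) - graphPt u x₀‖ ≤ L * 2 * ‖y - x₀‖ := by
    calc _ ≤ L * ‖dir y - x₀‖ := hlip _ hyΩ _ (hKΩ hx₀)
      _ ≤ L * (2 * ‖y - x₀‖) := by gcongr
      _ = _ := by ring
  have hY1 : ‖Y - Y'‖ ≤ C * 2 ^ α * ‖y - x₀‖ ^ α := by
    calc _ ≤ C * ‖dir y - x₀‖ ^ α := hhol _ hy _ hY'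
      _ ≤ C * (2 * ‖y - x₀‖) ^ α := by gcongr
      _ = _ := by rw [Real.mul_rpow (by norm_num) (norm_nonneg _)]; ring
  have hprod : Cm * ‖graphPt u (dir y) - graphPt u x₀‖ * ‖Y - Y'‖ ≤
      Cm * (L * 2 * ‖y - x₀‖) * (C * 2 ^ α * ‖y - x₀‖ ^ α) := by gcongr
  change |u (dir y) - h κ (dir y) Y (u x₀ • x₀)| ≤ _
  rw [abs_of_nonneg (by linarith), div_mul_eq_mul_div, le_div_iff₀ h1κ]
  linarith

end NearField

end

/-! ### The regularity theorem -/

theorem theorem5p5 (n : ℕ) (hn : 2 ≤ n) (κ c₁ c₂ : ℝ) (hκ0 : 0 < κ) (hκ1 : κ < 1)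
    (hc₁ : 0 < c₁) (hc₂ : c₁ < c₂)
    (Ω T : Set (NearField.Space n))
    (hΩ : ∃ U : Set (NearField.Space n), IsOpen U ∧ Ω = U ∩ NearField.unitSphere n)
    (E : NearField.Space n → Set (NearField.Space n))
    (s : NearField.Space n → NearField.Space n → ℝ)
    (hA : NearField.HypA κ c₁ c₂ Ω T E s)
    (hB : NearField.HypB κ c₁ c₂ Ω T)
    (hC : NearField.HypC κ c₁ c₂ Ω E s)
    (hD : NearField.HypD κ c₁ c₂ Ω T s)
    (u : NearField.Space n → ℝ)
    (hu : NearField.IsRefractor κ c₁ c₂ Ω T u)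
    (hmeas : NearField.MeasureBound κ Ω T u) :
    NearField.IsC1HolderLoc (1 / (4 * (n : ℝ) - 5)) Ω u ∧
      ∀ x₀ ∈ Ω, ∃ Y : NearField.Space n,
        NearField.subdiff κ Ω T u x₀ = {Y} ∧
          ∃ g : NearField.Space n,
            HasGradientAt (fun x => NearField.h κ x Y (u x₀ • x₀)) g x₀ ∧
              HasGradientAt (NearField.radialExt u) (g - (inner ℝ g x₀) • x₀) x₀ := by
  open NearField in
  have hΩs : Ω ⊆ unitSphere n := by
    obtain ⟨U, -, rfl⟩ := hΩ
    exact Set.inter_subset_right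
  have hn' : (2 : ℝ) ≤ n := by exact_mod_cast hn
  have hα : 0 < 1 / (4 * (n : ℝ) - 5) := one_div_pos.2 (by linarith)
  have hα1 : 1 / (4 * (n : ℝ) - 5) ≤ 1 := by
    rw [div_le_one (by linarith)]; linarith
  have hc₂0 : 0 < c₂ := hc₁.trans hc₂
  have hh : ∀ x₀ ∈ Ω, ∀ Y ∈ T, HasGradientAt (fun x => h κ x Y (u x₀ • x₀))
      ((κ * u x₀ / obliquity κ x₀ (Y - u x₀ • x₀)) • Y) x₀ := fun x₀ hx₀ Y hY =>
    hasGradientAt_h hκ0 hκ1 (by simpa using hΩs hx₀) (hc₁.trans_le (hu.1 x₀ hx₀).1)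
      (hA.polar (hu.graphPt_mem hx₀) hY).2.2
  have hmap : ∀ K : Set (Space n), IsCompact K → K ⊆ Ω → ∃ C, 0 ≤ C ∧ ∀ xb ∈ K, ∀ xh ∈ K,
      ∀ Yb ∈ subdiff κ Ω T u xb, ∀ Yh ∈ subdiff κ Ω T u xh,
      ‖Yb - Yh‖ ≤ C * ‖xb - xh‖ ^ (1 / (4 * (n : ℝ) - 5)) := fun K hK hKΩ =>
    exists_norm_sub_le_rpow hn hκ0 hκ1 hc₁ hc₂ hΩ hA hB hC hD hu hmeas hK hKΩ
  have hgrad : ∀ x₀ ∈ Ω, ∀ Y ∈ subdiff κ Ω T u x₀, ∀ g : Space n,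
      HasGradientAt (fun x => h κ x Y (u x₀ • x₀)) g x₀ →
      HasGradientAt (radialExt u) (g - (inner ℝ g x₀) • x₀) x₀ := by
    intro x₀ hx₀ Y hY g hg
    obtain ⟨K, hKΩ, hK, hx₀K, hev⟩ := exists_compact_eventually_dir_mem hΩ hx₀
    obtain ⟨C, hC0, hhol⟩ := hmap K hK hKΩ
    refine hu.hasGradientAt_radialExt hκ0 hκ1 hc₁ hc₂ hΩs hA hB hKΩ hα hC0 hx₀K hev hY ?_ hg
    intro x hx Y' hY'
    rw [norm_sub_rev x x₀]
    exact hhol x₀ hx₀K x hx Y hY Y' hY'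
  have htan : ∀ x₀ ∈ Ω, ∀ Y ∈ subdiff κ Ω T u x₀,
      HasGradientAt (radialExt u) (ovalTangent κ (u x₀) x₀ (Y - u x₀ • x₀)) x₀ := by
    intro x₀ hx₀ Y hY
    have := hgrad x₀ hx₀ Y hY _ (hh x₀ hx₀ Y hY.1)
    rwa [tangential_smul_eq_ovalTangent (by simpa using hΩs hx₀)] at this
  refine ⟨⟨fun x hx => ?_, fun K hKΩ hK => ?_⟩, fun x₀ hx₀ => ?_⟩
  · obtain ⟨Y, hY⟩ := hu.2 x hx
    exact (htan x hx Y hY).differentiableAt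
  · obtain ⟨C, hC0, hhol⟩ := hmap K hK hKΩ
    obtain ⟨S, hS, hSd⟩ := hA.exists_dist_le hc₁ hΩs
    obtain ⟨L, hL, hlip⟩ := hu.exists_norm_graphPt_sub_le hκ0 hκ1 hc₁ hc₂ hΩs
    have h1κ : 0 < 1 - κ := by linarith
    obtain ⟨Ct, hCt, htl⟩ := exists_norm_ovalTangent_sub_le (n := n) κ c₂ S ((1 - κ) * (c₂ / κ))
      hκ0 hκ1 hS (by positivity) hc₂0
    obtain ⟨M, hM⟩ : ∃ M, M = 1 + κ * c₂ / (1 - κ) + L := ⟨_, rfl⟩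
    have hM0 : 0 ≤ κ * c₂ / (1 - κ) := by positivity
    refine ⟨Ct * (M * 2 + C), fun x hx y hy => ?_⟩
    have hx1 : ‖x‖ = 1 := by simpa using hΩs (hKΩ hx)
    have hy1 : ‖y‖ = 1 := by simpa using hΩs (hKΩ hy)
    obtain ⟨Y, hY⟩ := hu.2 x (hKΩ hx)
    obtain ⟨Y', hY'⟩ := hu.2 y (hKΩ hy)
    rw [(htan x (hKΩ hx) Y hY).gradient, (htan y (hKΩ hy) Y' hY').gradient, mul_assoc]
    -- Halving brings the distance of two unit vectors below `1`, where lowering the exponent to `α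
    -- ≤ 1` increases the power.
    have hdle : ‖x - y‖ ≤ 2 * ‖x - y‖ ^ (1 / (4 * (n : ℝ) - 5)) := by
      have h2 : ‖x - y‖ / 2 ≤ 1 := by
        have := norm_sub_le x y
        rw [hx1, hy1] at this
        linarith
      have h3 := Real.rpow_le_rpow_of_exponent_ge' (by positivity) h2 hα.le hα1
      rw [Real.rpow_one] at h3
      have h4 : (‖x - y‖ / 2) ^ (1 / (4 * (n : ℝ) - 5)) ≤ ‖x - y‖ ^ (1 / (4 * (n : ℝ) - 5)) :=
        Real.rpow_le_rpow (by positivity) (by linarith [norm_nonneg (x - y)]) hα.le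
      linarith
    obtain ⟨p, hp⟩ : ∃ p, p = ‖x - y‖ ^ (1 / (4 * (n : ℝ) - 5)) := ⟨_, rfl⟩
    have hhol' := hhol x hx y hy Y hY Y' hY'
    rw [← hp] at hdle hhol' ⊢
    have hp0 : 0 ≤ p := by rw [hp]; positivity
    have hMp : M * ‖x - y‖ ≤ M * 2 * p := by
      rw [mul_assoc]
      refine mul_le_mul_of_nonneg_left hdle ?_
      linarith
    have hMe : M * ‖x - y‖ = ‖x - y‖ + κ * c₂ / (1 - κ) * ‖x - y‖ + L * ‖x - y‖ := by
      rw [hM]; ring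
    have hn0 := norm_nonneg (x - y)
    have ht1 : 0 ≤ κ * c₂ / (1 - κ) * ‖x - y‖ := by positivity
    have ht2 : 0 ≤ L * ‖x - y‖ := by positivity
    have ht3 : 0 ≤ C * p := by positivity
    have hob : ∀ z ∈ Ω, ∀ W ∈ T, (1 - κ) * (c₂ / κ) ≤ obliquity κ z (W - u z • z) := by
      intro z hz W hW
      refine le_trans ?_ (le_obliquity hκ0 (by simpa using hΩs hz) _)
      refine mul_le_mul_of_nonneg_left ?_ h1κ.le
      rw [div_le_iff₀' hκ0]
      exact hB.le_dist hA hκ0 hc₁ hc₂ hΩs (hu.graphPt_mem hz) hW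
    refine htl x y _ _ _ _ _ hx1 hy1 (hSd _ (hu.graphPt_mem (hKΩ hx)) Y hY.1)
      (hSd _ (hu.graphPt_mem (hKΩ hy)) Y' hY'.1) (hc₁.le.trans (hu.1 x (hKΩ hx)).1)
      (hc₁.le.trans (hu.1 y (hKΩ hy)).1) (hu.1 y (hKΩ hy)).2 (hob x (hKΩ hx) Y hY.1)
      (hob y (hKΩ hy) Y' hY'.1) ?_ ?_ ?_
    · linarith
    · have e : Y - u x • x - (Y' - u y • y) = (Y - Y') - (graphPt u x - graphPt u y) := by
        unfold graphPt; abel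
      rw [e]
      refine (norm_sub_le _ _).trans ?_
      linarith [hlip x (hKΩ hx) y (hKΩ hy)]
    · linarith [hu.abs_sub_le hκ0 hκ1 hc₁ hΩs (hKΩ hx) (hKΩ hy)]
  · obtain ⟨Y, hY⟩ := hu.2 x₀ hx₀
    refine ⟨Y, ?_, _, hh x₀ hx₀ Y hY.1, hgrad x₀ hx₀ Y hY _ (hh x₀ hx₀ Y hY.1)⟩
    -- On the compact set `{x₀}` the Hölder estimate reads `|Y' - Y| ≤ C · 0^α = 0`.
    obtain ⟨C, hC0, hhol⟩ := hmap {x₀} isCompact_singleton (Set.singleton_subset_iff.2 hx₀)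
    refine Set.eq_singleton_iff_unique_mem.2 ⟨hY, fun Y' hY' => ?_⟩
    have := hhol x₀ rfl x₀ rfl Y' hY' Y hY
    rw [sub_self, norm_zero, Real.zero_rpow hα.ne', mul_zero] at this
    exact sub_eq_zero.1 (norm_le_zero_iff.1 this)
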